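/- Let $\mathbb{F}_q$ be a finite field with algebraic closure $\overline{\mathbb{F}}_q$, and let $E/\mathbb{F}_q$ be an elliptic curve with zero element $\mathcal{O}$ such that $N=|E(\mathbb{F}_q)|$ is even. For a divisor $G=\sum n_Q[Q]$ on $E(\overline{\mathbb{F}}_q)$ put $\operatorname{sum}(G)=\sum n_Q Q\in E(\overline{\mathbb{F}}_q)$. Identify a place $R$ of degree $l$ of $\mathbb{F}_q(E)$ with the corresponding $\operatorname{Gal}(\overline{\mathbb{F}}_q/\mathbb{F}_q)$-orbit of $l$ points of $E(\overline{\mathbb{F}}_q)$, and write $[R]$ for the sum of these points as a divisor. For a set $\mathcal{D}\subseteq E(\mathbb{F}_q)$ and a Galois-invariant divisor $G$ whose support is disjoint from $\mathcal{D}$, let $$C(E,\mathcal{D},G)=\{(f(P))_{P\in\mathcal{D}} : f\in L(G)\}\subseteq\mathbb{F}_q^{|\mathcal{D}|},\qquad L(G)=\{f\in\mathbb{F}_q(E)^\times : \operatorname{div}(f)+G\ge 0\}\cup\{0\}.$$ A linear code of length $n$ and dimension $k$ is MDS if its minimum distance is $n-k+1$. Assume that there is a place $R$ of odd degree $l>2$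 with $\operatorname{sum}([R])=\mathcal{O}$. Then for every integer $k$ with $l\le k\le N/2$ there exist $\mathcal{D}$ and $G$ as above such that $C(E,\mathcal{D},G)$ is an MDS code of length $N/2$ and dimension $k$. More precisely, $E(\mathbb{F}_q)$ has a subgroup of index $2$, and for every such subgroup $H$, every $u\in E(\mathbb{F}_q)\setminus H$ and all (not necessarily distinct) $P_1,\dots,P_{k-l}\in E(\mathbb{F}_q)$, with $G=[R]+[P_1]+\cdots+[P_{k-l}]$: 1. if $k$ is even and all $P_i\in u+H$, then $C(E,H,G)$ is an MDS code of length $N/2$ and dimension $k$, and $H\cap\operatorname{Supp}(G)=\emptyset$; 2. if $k$ is odd and all $P_i\in H$, then $C(E,u+H,G)$ is an MDS code of length $N/2$ and dimension $k$, and $(u+H)\cap\operatorname{Supp}(G)=\emptyset$. -/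

import Mathlib

open WeierstrassCurve Polynomial

open scoped nonZeroDivisors

noncomputable section

namespace EllipticCode

universe u v

section Curve

variable {K : Type u} [Field K] (W : WeierstrassCurve.Affine K)

/-- The order of vanishing at a point `P` of a nonzero regular function `r` on the affine part of a
Weierstrass curve. At an affine point `(x, y)` it is the largest `n` such that `r` lies in the
`n`-th power of the maximal ideal `(X - x, Y - y)` of the coordinate ring. At the point at infinity
it is minus the degree (in `X`) of the norm of `r` down to `K[X]`: this is the valuation of `K(X)`
at infinity composed with the norm, that is, the normalised valuation of the unique place above
`X = ∞`, for which `X` has a pole of order `2` and `Y` has a pole of order `3`. -/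
def ringOrd : W.Point → W.CoordinateRing → ℤ
  | .zero, r => -((Algebra.norm K[X] r).natDegree : ℤ)
  | .some x y _, r => ((sSup {n : ℕ | r ∈ Affine.CoordinateRing.XYIdeal W x (C y) ^ n} : ℕ) : ℤ)

/-- The valuation `v_P(f)` of a nonzero rational function `f` at a point `P`: writing `f = r / s`
with `r` and `s` in the coordinate ring, it is the difference of the orders of `r` and `s`. -/
def ord (P : W.Point) (f : W.FunctionField) : ℤ :=
  ringOrd W P (IsLocalization.sec W.CoordinateRing⁰ f).1 -
    ringOrd W P (IsLocalization.sec W.CoordinateRing⁰ f).2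

end Curve

variable {F : Type u} [Field F] (E : WeierstrassCurve F) (K : Type v) [Field K] [Algebra F K]

/-- The set `E(K)` of points of `E` over an extension `K` of the base field
(it contains the point at infinity, which is `0`). -/
abbrev Pts : Type v := (E.baseChange K).toAffine.Point

/-- The inclusion of `F(E)` into the function field `K(E)` of the curve over an extension `K`. -/
def funMap : E.toAffine.FunctionField →+* (E.baseChange K).toAffine.FunctionField :=
  IsFractionRing.map (A := E.toAffine.CoordinateRing)
    (B := (E.baseChange K).toAffine.CoordinateRing)
    (j := Affine.CoordinateRing.map E.toAffine (algebraMap F K))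
    (Affine.CoordinateRing.map_injective (algebraMap F K).injective)

/-- Divisors: the free abelian group on the points of `E` over `K`, where `K` is an algebraic
closure of `F` in all applications. -/
abbrev Divisor : Type v := Pts E K →₀ ℤ

variable {E K}

/-- A divisor is rational over `F` if it is invariant under the automorphisms of `K` over `F`. -/
def IsRational [DecidableEq K] (G : Divisor E K) : Prop :=
  ∀ (σ : K ≃ₐ[F] K) (Q : Pts E K), G (Affine.Point.map (W' := E) (σ : K →ₐ[F] K) Q) = G Q

/-- `sum(G) = ∑ n_Q Q`, computed in the group `E(K)`. -/
def divisorSum [DecidableEq K] (G : Divisor E K) : Pts E K :=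
  G.sum fun Q n => n • Q

/-- A place of `F(E)`, given as a Galois orbit of points over the algebraic closure `K` of `F`.
Its degree is the number of points in the orbit. -/
def IsPlace [DecidableEq K] (R : Finset (Pts E K)) : Prop :=
  ∃ Q : Pts E K, ∀ Q' : Pts E K,
    Q' ∈ R ↔ ∃ σ : K ≃ₐ[F] K, Affine.Point.map (W' := E) (σ : K →ₐ[F] K) Q = Q'

/-- The divisor `[R]`: the sum of the points of the orbit `R`, each with multiplicity one. -/
def placeDivisor (R : Finset (Pts E K)) : Divisor E K :=
  ∑ Q ∈ R, Finsupp.single Q 1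

/-- The divisor `[P]` of a rational point `P ∈ E(F)`. -/
def pointDivisor [DecidableEq F] [DecidableEq K] (P : Pts E F) : Divisor E K :=
  Finsupp.single (Affine.Point.baseChange (W' := E) F K P) 1

/-- The Riemann-Roch space `L(G)`, inside the function field `F(E)`. -/
def riemannRoch (G : Divisor E K) : Set E.toAffine.FunctionField :=
  {f | f = 0 ∨ ∀ Q : Pts E K, 0 ≤ ord (E.baseChange K).toAffine Q (funMap E K f) + G Q}

/-- `f(P) = c` at a rational point `P ∈ E(F)`: the function `f` is regular at `P` with residue `c`,
that is, `f - c` vanishes at `P`. -/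
def HasValueAt [DecidableEq F] [DecidableEq K] (f : E.toAffine.FunctionField) (P : Pts E F) (c : F) :
    Prop :=
  f - algebraMap F E.toAffine.FunctionField c = 0 ∨
    0 < ord (E.baseChange K).toAffine (Affine.Point.baseChange (W' := E) F K P)
      (funMap E K (f - algebraMap F E.toAffine.FunctionField c))

/-- The words of `C(E, D, G)`: the vectors `(f(P))_{P ∈ D}` with `f ∈ L(G)`. -/
def agCode [DecidableEq F] [DecidableEq K] (D : Finset (Pts E F)) (G : Divisor E K) :
    Set (D → F) :=
  {c | ∃ f ∈ riemannRoch G, ∀ P : D, HasValueAt (K := K) f (P : Pts E F) (c P)}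

/-- The minimum distance of a code. -/
def minDist [DecidableEq F] {ι : Type*} [Fintype ι] (C : Set (ι → F)) : ℕ :=
  sInf {d | ∃ x ∈ C, ∃ y ∈ C, x ≠ y ∧ hammingDist x y = d}

/-- `D` and `G` are admissible data for an elliptic code (`G` is a rational divisor whose support
is disjoint from `D`), and `C(E, D, G)` is a linear code of length `n` and dimension `k` which is
MDS: its minimum distance is `n - k + 1`. -/
def IsMDSEllipticCode [DecidableEq F] [DecidableEq K] (D : Finset (Pts E F)) (G : Divisor E K)
    (n k : ℕ) : Prop :=
  IsRational G ∧
  (∀ P ∈ D, Affine.Point.baseChange (W' := E) F K P ∉ G.support) ∧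
  D.card = n ∧
  ∃ C : Submodule F (D → F), (C : Set (D → F)) = agCode D G ∧
    Module.finrank F C = k ∧ minDist (C : Set (D → F)) + k = n + 1

end EllipticCode

end

open scoped Polynomial.Bivariate

noncomputable section

/-! Put $G=[R]+\sum[P_i]$, of degree $k$. A nonzero $f\in L(G)$ vanishing at a $k$-subset $T$ of $D$
satisfies $\operatorname{div}(f)\ge\sum_{P\in T}[P]-G$ with degree $0$ on both sides, so equality
holds. Principal divisors have sum zero and $\operatorname{sum}([R])=0$, hence $\sum_{P\in T}P=\sum
P_i$. Reduction modulo $H$ forbids this. If $k$ is even, the left side lies in $H$ and the right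
side is a sum of an odd number $k-l$ of elements outside $H$; if $k$ is odd, the right side lies in
$H$ and the left side is a sum of an odd number $k$ of elements outside it. So nonzero words have
fewer than $k$ zeros (`sumHom_eq_of_zeros`, `sum_mem_iff_even`), and the code is MDS once $\dim
L(G)\ge k$ (`finrank_and_minDist`).

That bound needs no general Riemann-Roch theorem. The functions $X^i$, $X^iY$ give $\dim
L(m[\mathcal O])\ge m$. Since $R$ sums to zero, $[R]-l[\mathcal O]$ is the divisor of a function
over $F$ (`exists_function_place`), and vertical lines give $[P]+[-P]\sim 2[\mathcal O]$. Removing a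
rational point costs at most one dimension (`le_rank_rrSpace_sub_single`). Hence $\dim
L(G)\ge(l+2(k-l))-(k-l)=k$.

The divisor theory comes from the coordinate ring over an algebraically closed field: it is
Dedekind, norms to $K[X]$ give degrees, and the injection of the point group into the class group
gives sums. The pole filtration at infinity is read off coefficients in the basis $X^i$, $X^iY$,
which also makes Galois descent explicit. -/

namespace EllipticCode


/-! ### The affine coordinate ring is Dedekind; norms of point ideals. -/

section Dedekind

variable {K : Type*} [Field K] {W : WeierstrassCurve.Affine K}

open Affine.CoordinateRing

lemma XYIdeal_isMaximal {x y : K} (h : W.Equation x y) : (XYIdeal W x (C y)).IsMaximal := by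
  have e := quotientXYIdealEquiv (W' := W) (x := x) (y := C y) h
  exact Ideal.Quotient.maximal_of_isField _
    (MulEquiv.isField (Field.toIsField K) e.toMulEquiv)

/-- Weak Nullstellensatz: the residue field is finite over $K$, hence equal to $K$, and the residues
of $X$ and $Y$ are the coordinates. Ellipticity makes the point nonsingular. -/
lemma exists_XYIdeal_eq [IsAlgClosed K] [W.IsElliptic] (M : Ideal W.CoordinateRing)
    (hM : M.IsMaximal) : ∃ (x y : K) (_ : W.Nonsingular x y), M = XYIdeal W x (C y) := by
  let _ := Ideal.Quotient.field M
  have : Algebra.FiniteType K (W.CoordinateRing ⧸ M) := by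
    have : Algebra.FiniteType K W.CoordinateRing := inferInstance
    infer_instance
  have hfin := finite_of_finite_type_of_isJacobsonRing K (W.CoordinateRing ⧸ M)
  have hsurj : Function.Surjective (algebraMap K (W.CoordinateRing ⧸ M)) :=
    (IsAlgClosed.algebraMap_bijective_of_isIntegral (k := K)).2
  obtain ⟨x, hx⟩ := hsurj (Ideal.Quotient.mk M (mk W (C X)))
  obtain ⟨y, hy⟩ := hsurj (Ideal.Quotient.mk M (mk W Y))
  have key : ∀ p : K[X][Y], Ideal.Quotient.mk M (mk W p) =
      algebraMap K (W.CoordinateRing ⧸ M) (p.evalEval x y) := by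
    intro p
    have : ((Ideal.Quotient.mk M).comp (mk W)) =
        (algebraMap K (W.CoordinateRing ⧸ M)).comp (evalEvalRingHom x y) := by
      apply Polynomial.ringHom_ext
      · intro q
        induction q using Polynomial.induction_on' with
        | add p q hp hq => simp only [map_add, hp, hq]
        | monomial n a =>
          rw [← C_mul_X_pow_eq_monomial]
          simp only [map_mul, map_pow, RingHom.comp_apply, ← hx]
          simp only [coe_evalRingHom, eval_C, eval_X]
          rfl
      · simpa using hy.symm
    exact congrArg (fun f => f p) this
  have heq : W.Equation x y := by
    have := key W.polynomial
    rw [AdjoinRoot.mk_self, map_zero] at this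
    exact ((algebraMap K (W.CoordinateRing ⧸ M)).injective (by rw [← this, map_zero]))
  refine ⟨x, y, Affine.equation_iff_nonsingular.mp heq, ?_⟩
  refine ((XYIdeal_isMaximal heq).eq_of_le hM.ne_top ?_).symm
  rw [XYIdeal, Ideal.span_le]
  rintro _ (rfl | rfl)
  · rw [SetLike.mem_coe, ← Ideal.Quotient.eq_zero_iff_mem, XClass, key]; simp [evalEval_C]
  · rw [SetLike.mem_coe, ← Ideal.Quotient.eq_zero_iff_mem, YClass, key]; simp [evalEval_C]

/-- Noetherian induction on larger ideals. Choose $M\supseteq I$ maximal and $M'$ the ideal of the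
negated point, so $MM'=(t)$ with $t=X-x$. Then $IM'=tJ$ with $I\subseteq J$, and $J=I$ would give
$I=MI$, which Nakayama excludes in a domain. -/
lemma exists_mul_eq_span_singleton [IsAlgClosed K] [W.IsElliptic] (I : Ideal W.CoordinateRing)
    (hI : I ≠ ⊥) : ∃ J : Ideal W.CoordinateRing, ∃ c ≠ 0, I * J = Ideal.span {c} := by
  induction I using IsNoetherian.induction with
  | hgt I ih =>
  by_cases hT : I = ⊤
  · exact ⟨⊤, 1, one_ne_zero, by simp [hT]⟩
  obtain ⟨M, hM, hIM⟩ := Ideal.exists_le_maximal I hT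
  obtain ⟨x, y, h, rfl⟩ := exists_XYIdeal_eq M hM
  have hneg := XYIdeal_neg_mul h
  set M := XYIdeal W x (C y)
  set M' := XYIdeal W x (C (W.negY x y))
  set t := XClass W x
  have ht : t ≠ 0 := XClass_ne_zero x
  rw [XIdeal] at hneg
  have h1 : I * M' ≤ Ideal.span {t} := by
    rw [← hneg, mul_comm M']
    exact Ideal.mul_mono_left hIM
  obtain ⟨J, hJ⟩ : ∃ J : Ideal W.CoordinateRing, I * M' = Ideal.span {t} * J := by
    refine ⟨(I * M').comap (LinearMap.mulLeft W.CoordinateRing t), ?_⟩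
    refine (Ideal.eq_span_singleton_mul _ _).mpr ⟨fun z hz => ?_, fun z hz => hz⟩
    obtain ⟨w, rfl⟩ := Ideal.mem_span_singleton'.mp (h1 hz)
    exact ⟨w, by simpa [mul_comm] using hz, mul_comm _ _⟩
  have hle : I ≤ J := by
    rw [← Ideal.span_singleton_mul_right_mono ht, ← hJ, ← hneg, mul_assoc, mul_comm]
    exact Ideal.mul_mono_left Ideal.mul_le_right
  have hne : I ≠ J := by
    rintro rfl
    have h2 : I = M * I := by
      apply Ideal.span_singleton_mul_right_injective ht
      change Ideal.span {t} * I = Ideal.span {t} * (M * I)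
      rw [mul_left_comm, ← hJ, mul_left_comm, mul_comm M M', hneg, hJ, mul_comm]
    obtain ⟨r, hr, hr0⟩ := Submodule.exists_sub_one_mem_and_smul_eq_zero_of_fg_of_le_smul M I
      (IsNoetherian.noetherian I) (by rw [smul_eq_mul, ← h2])
    obtain ⟨a, ha, ha0⟩ := Submodule.exists_mem_ne_zero_of_ne_bot hI
    have : r = 0 := by simpa [ha0] using hr0 a ha
    rw [this, zero_sub] at hr
    exact hM.ne_top ((Ideal.eq_top_iff_one _).mpr (by simpa using M.neg_mem hr))
  have hJ0 : J ≠ ⊥ := fun h => hI (le_bot_iff.mp (h ▸ hle))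
  obtain ⟨J', c, hc, hJ'⟩ := ih J (lt_of_le_of_ne hle hne) hJ0
  exact ⟨M' * J', t * c, mul_ne_zero ht hc, by
    rw [← mul_assoc, hJ, mul_assoc, hJ', Ideal.span_singleton_mul_span_singleton]⟩

instance [IsAlgClosed K] [W.IsElliptic] : IsDedekindDomain W.CoordinateRing := by
  rw [isDedekindDomain_iff_mul_inv_cancel (K := FractionRing W.CoordinateRing)]
  intro I hI
  obtain ⟨a, J, ha, hIJ⟩ := FractionalIdeal.exists_eq_spanSingleton_mul I
  have hJ : J ≠ ⊥ := by
    rintro rfl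
    exact hI (by simpa using hIJ)
  obtain ⟨J', c, hc, hJ'⟩ := exists_mul_eq_span_singleton J hJ
  rw [FractionalIdeal.mul_inv_cancel_iff]
  -- With $I=a^{-1}J$ and $JJ'=(c)$, the inverse of $I$ is $(a/c)J'$.
  refine ⟨FractionalIdeal.spanSingleton _ (algebraMap _ _ a / algebraMap _ _ c) * (J' : FractionalIdeal _ _), ?_⟩
  have hc' : algebraMap _ (FractionRing W.CoordinateRing) c ≠ 0 := by simpa using hc
  have ha' : algebraMap _ (FractionRing W.CoordinateRing) a ≠ 0 := by simpa using ha
  rw [hIJ, mul_mul_mul_comm, ← FractionalIdeal.coeIdeal_mul, hJ', FractionalIdeal.coeIdeal_span_singleton,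
    FractionalIdeal.spanSingleton_mul_spanSingleton, FractionalIdeal.spanSingleton_mul_spanSingleton]
  rw [← FractionalIdeal.spanSingleton_one]
  congr 1
  field_simp

instance : Module.Finite K[X] W.CoordinateRing := .of_basis (Affine.CoordinateRing.basis W)

lemma relNorm_span_singleton [IsAlgClosed K] [W.IsElliptic] (r : W.CoordinateRing) :
    Ideal.relNorm K[X] (Ideal.span {r}) = Ideal.span {Algebra.norm K[X] r} := by
  rw [Ideal.relNorm_singleton, Algebra.intNorm_eq_norm]

lemma norm_XClass (x : K) : Algebra.norm K[X] (XClass W x) = (X - C x) ^ 2 := by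
  have := norm_smul_basis (W' := W) (X - C x) 0
  rwa [zero_smul, add_zero, Affine.CoordinateRing.smul, mul_one, zero_pow two_ne_zero, mul_zero,
    zero_mul, zero_mul, sub_zero, sub_zero] at this

/-- The ideals of a point and of its negative have product $(X-x)$, whose norm is $(X-x)^2$. Proper
ideals have proper norm, so each factor takes exactly one copy of the prime $X-x$. -/
lemma relNorm_XYIdeal [IsAlgClosed K] [W.IsElliptic] {x y : K} (h : W.Nonsingular x y) :
    Ideal.relNorm K[X] (XYIdeal W x (C y)) = Ideal.span {X - C x} := by
  have hne : ∀ I : Ideal W.CoordinateRing, I ≠ ⊤ → Ideal.relNorm K[X] I ≠ ⊤ := by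
    intro I hI h
    have := Ideal.relNorm_le_comap K[X] I
    rw [h, top_le_iff, Ideal.comap_eq_top_iff] at this
    exact hI this
  have hmul : Ideal.relNorm K[X] (XYIdeal W x (C (W.negY x y))) *
      Ideal.relNorm K[X] (XYIdeal W x (C y)) = Ideal.span {(X - C x) ^ 2} := by
    rw [← map_mul, XYIdeal_neg_mul h, XIdeal, relNorm_span_singleton, norm_XClass]
  have h1 := hne _ (XYIdeal_isMaximal ((Affine.equation_neg ..).mpr h.1)).ne_top
  have h2 := hne _ (XYIdeal_isMaximal h.1).ne_top
  obtain ⟨a, ha⟩ := (IsPrincipalIdealRing.principal (Ideal.relNorm K[X] (XYIdeal W x (C (W.negY x y)))))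
  obtain ⟨b, hb⟩ := (IsPrincipalIdealRing.principal (Ideal.relNorm K[X] (XYIdeal W x (C y))))
  rw [Ideal.submodule_span_eq] at ha hb
  rw [ha] at h1
  rw [hb] at h2
  rw [ha, hb, Ideal.span_singleton_mul_span_singleton, Ideal.span_singleton_eq_span_singleton] at hmul
  rw [Ne, Ideal.span_singleton_eq_top] at h1 h2
  rw [hb, Ideal.span_singleton_eq_span_singleton]
  have hX : Prime (X - C x : K[X]) := prime_X_sub_C x
  obtain ⟨i, hi, hbi⟩ := (dvd_prime_pow hX 2).mp ((dvd_mul_left b a).trans hmul.dvd)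
  interval_cases i
  · exact (h2 (by simpa using hbi)).elim
  · simpa using hbi
  · refine (h1 ?_).elim
    have h3 : Associated (a * b) (1 * b) := by rw [one_mul]; exact hmul.trans hbi.symm
    have hb0 : b ≠ 0 := fun h => by
      rw [h] at hbi
      exact pow_ne_zero 2 hX.ne_zero (associated_zero_iff_eq_zero _ |>.mp hbi.symm)
    exact associated_one_iff_isUnit.mp (h3.of_mul_right (Associated.refl b) hb0)

end Dedekind


/-! ### Zeros of regular functions through ideal factorisation. -/

section Zeros

variable {K : Type*} [Field K] {W : WeierstrassCurve.Affine K}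

open Affine.CoordinateRing

/-- The ideal of functions in the coordinate ring vanishing at an affine point, extended by the unit
ideal at the point at infinity. -/
def pointIdeal : W.Point → Ideal W.CoordinateRing
  | .zero => ⊤
  | .some x y _ => XYIdeal W x (C y)

/-- The invertible fractional ideal of a point. -/
def pointUnit : W.Point → (FractionalIdeal W.CoordinateRing⁰ W.FunctionField)ˣ
  | .zero => 1
  | .some _ _ h => XYIdeal' h

lemma coe_pointUnit (P : W.Point) : (pointUnit P : FractionalIdeal W.CoordinateRing⁰ W.FunctionField) =
    (pointIdeal P : Ideal W.CoordinateRing) := by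
  cases P with
  | zero => simp [pointUnit, pointIdeal]
  | some x y h => rfl

lemma toClass_eq_mk_pointUnit [DecidableEq K] (P : W.Point) :
    Affine.Point.toClass P = Additive.ofMul (ClassGroup.mk W.FunctionField (pointUnit P)) := by
  cases P with
  | zero => exact (congrArg Additive.ofMul (map_one _)).symm
  | some x y h => rfl

/-- Sending a point to its ideal class is an injective homomorphism, so the sum vanishes exactly
when the product of the ideals is principal. Both directions are used: to compute sums of principal
divisors, and to produce functions. -/
lemma sum_eq_zero_iff [DecidableEq K] (s : Multiset W.Point) :
    s.sum = 0 ↔ ∃ c ≠ 0, (s.map pointIdeal).prod = Ideal.span {c} := by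
  have h1 : Affine.Point.toClass s.sum =
      Additive.ofMul (ClassGroup.mk W.FunctionField (s.map pointUnit).prod) := by
    induction s using Multiset.induction_on with
    | empty => simp
    | cons a s ih =>
      rw [Multiset.sum_cons, map_add, ih, toClass_eq_mk_pointUnit, Multiset.map_cons,
        Multiset.prod_cons, map_mul, ofMul_mul]
  have h2 : (((s.map pointUnit).prod : (FractionalIdeal W.CoordinateRing⁰ W.FunctionField)ˣ) :
      FractionalIdeal W.CoordinateRing⁰ W.FunctionField) =
      ((s.map pointIdeal).prod : Ideal W.CoordinateRing) := by
    clear h1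
    induction s using Multiset.induction_on with
    | empty => simp
    | cons a s ih => simp [ih, coe_pointUnit]
  rw [← Affine.Point.toClass_eq_zero, h1, ← ClassGroup.mk_eq_one_of_coe_ideal h2]
  rfl

lemma pointIdeal_isMaximal {P : W.Point} (hP : P ≠ 0) : (pointIdeal P).IsMaximal := by
  cases P with
  | zero => exact (hP rfl).elim
  | some x y h => exact XYIdeal_isMaximal h.1

lemma pointIdeal_ne_bot (P : W.Point) : pointIdeal P ≠ ⊥ := by
  cases P with
  | zero => simp [pointIdeal]
  | some x y h =>
    intro h0
    have : XClass W x ∈ pointIdeal (.some x y h) := Ideal.subset_span (by simp)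
    rw [h0] at this
    exact XClass_ne_zero x this

lemma algebraMap_sub_mem {P : W.Point} (hP : P ≠ 0) {a b : K}
    (h : algebraMap K W.CoordinateRing (a - b) ∈ pointIdeal P) : a = b := by
  by_contra hab
  refine (pointIdeal_isMaximal hP).ne_top (Ideal.eq_top_of_isUnit_mem _ h ?_)
  exact (IsUnit.mk0 _ (sub_ne_zero.mpr hab)).map _

lemma pointIdeal_injective : Function.Injective (pointIdeal (W := W)) := by
  have aux : ∀ P : W.Point, P ≠ 0 → pointIdeal P ≠ pointIdeal 0 := fun P hP h =>
    (pointIdeal_isMaximal hP).ne_top h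
  intro P Q h
  by_cases hP : P = 0
  · by_cases hQ : Q = 0
    · rw [hP, hQ]
    · subst hP; exact (aux Q hQ h.symm).elim
  by_cases hQ : Q = 0
  · subst hQ; exact (aux P hP h).elim
  cases P with
  | zero => exact (hP rfl).elim
  | some x y hxy =>
  cases Q with
  | zero => exact (hQ rfl).elim
  | some x' y' hxy' =>
    have hx : XClass W x ∈ pointIdeal (.some x y hxy) := Ideal.subset_span (by simp)
    have hy : YClass W (C y) ∈ pointIdeal (.some x y hxy) := Ideal.subset_span (by simp)
    have hx' : XClass W x' ∈ pointIdeal (.some x y hxy) := h ▸ Ideal.subset_span (by simp)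
    have hy' : YClass W (C y') ∈ pointIdeal (.some x y hxy) := h ▸ Ideal.subset_span (by simp)
    have h1 : x' = x := algebraMap_sub_mem hP (by
      have := Ideal.sub_mem _ hx hx'
      rw [XClass, XClass, ← map_sub] at this
      convert this using 1
      rw [← map_sub, sub_sub_sub_cancel_left, ← C_sub]; rfl)
    have h2 : y' = y := algebraMap_sub_mem hP (by
      have := Ideal.sub_mem _ hy hy'
      rw [YClass, YClass, ← map_sub] at this
      convert this using 1
      rw [sub_sub_sub_cancel_left, ← C_sub, ← C_sub]; rfl)
    subst h1 h2
    rfl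

lemma ringOrd_eq_sSup {P : W.Point} (hP : P ≠ 0) (r : W.CoordinateRing) :
    ringOrd W P r = ((sSup {n : ℕ | r ∈ pointIdeal P ^ n} : ℕ) : ℤ) := by
  cases P with
  | zero => exact (hP rfl).elim
  | some x y h => rfl

variable [IsAlgClosed K] [W.IsElliptic]

lemma pointIdeal_prime {P : W.Point} (hP : P ≠ 0) : Prime (pointIdeal P) :=
  Ideal.prime_of_isPrime (pointIdeal_ne_bot P) (pointIdeal_isMaximal hP).isPrime

lemma exists_prod_pointIdeal (I : Ideal W.CoordinateRing) (hI : I ≠ ⊥) :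
    ∃ s : Multiset W.Point, (∀ P ∈ s, P ≠ 0) ∧ (s.map pointIdeal).prod = I := by
  induction I using UniqueFactorizationMonoid.induction_on_prime with
  | h₁ => exact (hI rfl).elim
  | h₂ I hu => exact ⟨0, by simp, by simpa using (Ideal.isUnit_iff.mp hu).symm⟩
  | h₃ I p hI0 hp ih =>
    obtain ⟨s, hs, hsI⟩ := ih hI0
    have := (Ideal.isPrime_of_prime hp).isMaximal hp.ne_zero
    obtain ⟨x, y, h, rfl⟩ := exists_XYIdeal_eq p this
    refine ⟨Affine.Point.some x y h ::ₘ s, ?_, ?_⟩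
    · intro P hP
      rcases Multiset.mem_cons.mp hP with rfl | hP
      · exact Affine.Point.some_ne_zero h
      · exact hs P hP
    · rw [Multiset.map_cons, Multiset.prod_cons, hsI]; rfl

lemma mem_pointIdeal_pow_iff [DecidableEq W.Point] {s : Multiset W.Point} (hs : ∀ P ∈ s, P ≠ 0)
    {r : W.CoordinateRing} (hr : (s.map pointIdeal).prod = Ideal.span {r}) {P : W.Point}
    (hP : P ≠ 0) (n : ℕ) : r ∈ pointIdeal P ^ n ↔ n ≤ s.count P := by
  classical
  have hprod : (s.map pointIdeal).prod ≠ 0 := Multiset.prod_ne_zero (by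
    rw [Multiset.mem_map]; rintro ⟨Q, _, hQ⟩; exact pointIdeal_ne_bot Q hQ)
  rw [← Ideal.span_singleton_le_iff_mem, ← hr, ← Ideal.dvd_iff_le, pow_dvd_iff_le_emultiplicity,
    UniqueFactorizationMonoid.emultiplicity_eq_count_normalizedFactors
      (pointIdeal_prime hP).irreducible hprod,
    UniqueFactorizationMonoid.normalizedFactors_prod_of_prime, normalize_eq,
    Multiset.count_map_eq_count' _ _ pointIdeal_injective]
  · simp
  · intro p hp
    obtain ⟨Q, hQ, rfl⟩ := Multiset.mem_map.mp hp
    exact pointIdeal_prime (hs Q hQ)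

/-- Each point contributes one linear factor to the norm. Thus the pole order at infinity equals the
number of affine zeros, which is why principal divisors have degree zero. -/
lemma natDegree_norm_eq_card {s : Multiset W.Point} (hs : ∀ P ∈ s, P ≠ 0)
    {r : W.CoordinateRing} (hr : (s.map pointIdeal).prod = Ideal.span {r}) :
    (Algebra.norm K[X] r).natDegree = s.card := by
  have key : ∃ p : K[X], p.Monic ∧ p.natDegree = s.card ∧
      Ideal.relNorm K[X] (s.map pointIdeal).prod = Ideal.span {p} := by
    clear hr
    induction s using Multiset.induction_on with
    | empty => exact ⟨1, monic_one, by simp, by simp⟩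
    | cons P s ih =>
      obtain ⟨p, hp, hps, hpI⟩ := ih fun Q hQ => hs Q (Multiset.mem_cons_of_mem hQ)
      cases P with
      | zero => exact (hs _ (Multiset.mem_cons_self _ _) rfl).elim
      | some x y h =>
        refine ⟨(X - C x) * p, (monic_X_sub_C x).mul hp, ?_, ?_⟩
        · rw [(monic_X_sub_C x).natDegree_mul hp, hps, natDegree_X_sub_C, Multiset.card_cons,
            add_comm]
        · rw [Multiset.map_cons, Multiset.prod_cons, map_mul, hpI, pointIdeal, relNorm_XYIdeal h,
            Ideal.span_singleton_mul_span_singleton]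
  obtain ⟨p, hp, hps, hpI⟩ := key
  rw [hr, relNorm_span_singleton, Ideal.span_singleton_eq_span_singleton] at hpI
  rw [← hps, natDegree_eq_of_degree_eq (degree_eq_degree_of_associated hpI)]

lemma exists_zeros [DecidableEq K] {r : W.CoordinateRing} (hr : r ≠ 0) :
    ∃ s : Multiset W.Point, (∀ P ∈ s, P ≠ 0) ∧ (s.map pointIdeal).prod = Ideal.span {r} ∧
      (∀ P ≠ 0, ringOrd W P r = s.count P) ∧ ringOrd W 0 r = -s.card ∧ s.sum = 0 := by
  obtain ⟨s, hs, hsr⟩ := exists_prod_pointIdeal (Ideal.span {r}) (by simpa using hr)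
  refine ⟨s, hs, hsr, fun P hP => ?_, ?_, (sum_eq_zero_iff s).mpr ⟨r, hr, hsr⟩⟩
  · rw [ringOrd_eq_sSup hP]
    simp_rw [mem_pointIdeal_pow_iff hs hsr hP]
    exact congrArg _ (csSup_Iic (a := s.count P))
  · rw [← natDegree_norm_eq_card hs hsr]; rfl

end Zeros


/-! ### The pole filtration at infinity. -/

section Infinity

variable {K : Type*} [Field K] {W : WeierstrassCurve.Affine K}

open Affine.CoordinateRing

/-- The contributions of `p` and `q` have degrees of opposite parity and cannot cancel. The case `q
= 0` is separate because `natDegree` of zero is `0`, which would wrongly demand `3 ≤ n`. -/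
lemma natDegree_norm_smul_basis_le_iff (p q : K[X]) (n : ℕ) :
    (Algebra.norm K[X] (p • (1 : W.CoordinateRing) + q • mk W Y)).natDegree ≤ n ↔
      2 * p.natDegree ≤ n ∧ (q = 0 ∨ 2 * q.natDegree + 3 ≤ n) := by
  rw [natDegree_le_iff_degree_le, degree_norm_smul_basis, max_le_iff]
  refine and_congr ?_ ?_
  · by_cases hp : p = 0
    · simp [hp]
    · rw [degree_eq_natDegree hp, nsmul_eq_mul]; norm_cast
  · by_cases hq : q = 0
    · simp [hq]
    · rw [degree_eq_natDegree hq, or_iff_right hq, nsmul_eq_mul]; norm_cast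

/-- The coefficient of a regular function at the unique element of pole order `i` in the basis
`X ^ m`, `X ^ m * Y` of the coordinate ring (there is none of pole order `1`). -/
def poleCoeff (W : WeierstrassCurve.Affine K) (i : ℕ) : W.CoordinateRing →ₗ[K] K where
  toFun r := if Even i then (((Affine.CoordinateRing.basis W).repr r) 0).coeff (i / 2) else
    if i = 1 then 0 else (((Affine.CoordinateRing.basis W).repr r) 1).coeff ((i - 3) / 2)
  map_add' r s := by split_ifs <;> simp
  map_smul' c r := by
    have : c • r = (C c : K[X]) • r := by
      rw [← algebraMap_smul K[X] c r]; rfl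
    rw [this]
    split_ifs <;> simp

lemma poleCoeff_one (r : W.CoordinateRing) : poleCoeff W 1 r = 0 := by
  simp [poleCoeff]

lemma repr_smul_basis (p q : K[X]) :
    (Affine.CoordinateRing.basis W).repr (p • (1 : W.CoordinateRing) + q • mk W Y) =
      Finsupp.single 0 p + Finsupp.single 1 q := by
  rw [← Affine.CoordinateRing.basis_zero, ← Affine.CoordinateRing.basis_one, map_add, map_smul,
    map_smul, Module.Basis.repr_self, Module.Basis.repr_self]
  simp

lemma poleCoeff_even (p q : K[X]) (m : ℕ) :
    poleCoeff W (2 * m) (p • (1 : W.CoordinateRing) + q • mk W Y) = p.coeff m := by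
  rw [poleCoeff, LinearMap.coe_mk, AddHom.coe_mk, repr_smul_basis]
  simp

lemma poleCoeff_odd (p q : K[X]) (m : ℕ) :
    poleCoeff W (2 * m + 3) (p • (1 : W.CoordinateRing) + q • mk W Y) = q.coeff m := by
  have : ¬ Even (2 * m + 3) := by grind
  rw [poleCoeff, LinearMap.coe_mk, AddHom.coe_mk, repr_smul_basis]
  simp [this]

/-- Turns a bound on the pole order into linear conditions, from which compatibility with sums, base
change and conjugation is immediate. -/
lemma natDegree_norm_le_iff (r : W.CoordinateRing) (n : ℕ) :
    (Algebra.norm K[X] r).natDegree ≤ n ↔ ∀ i, n < i → poleCoeff W i r = 0 := by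
  obtain ⟨p, q, rfl⟩ := exists_smul_basis_eq r
  rw [natDegree_norm_smul_basis_le_iff]
  constructor
  · rintro ⟨hp, hq⟩ i hi
    obtain ⟨m, rfl | rfl⟩ := Nat.even_or_odd' i
    · rw [poleCoeff_even]
      exact coeff_eq_zero_of_natDegree_lt (by omega)
    · rcases m with _ | m
      · exact poleCoeff_one _
      · rw [show 2 * (m + 1) + 1 = 2 * m + 3 by ring, poleCoeff_odd]
        rcases hq with rfl | hq
        · simp
        · exact coeff_eq_zero_of_natDegree_lt (by omega)
  · intro h
    constructor
    · by_contra! hlt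
      have := h _ hlt
      rw [poleCoeff_even, coeff_natDegree, leadingCoeff_eq_zero] at this
      simp [this] at hlt
    · by_contra! hlt
      have := h _ hlt.2
      rw [poleCoeff_odd, coeff_natDegree, leadingCoeff_eq_zero] at this
      exact hlt.1 this

lemma poleCoeff_ext {r s : W.CoordinateRing} (h : ∀ i, poleCoeff W i r = poleCoeff W i s) :
    r = s := by
  obtain ⟨p, q, rfl⟩ := exists_smul_basis_eq r
  obtain ⟨p', q', rfl⟩ := exists_smul_basis_eq s
  have hp : p = p' := by
    ext m; simpa only [poleCoeff_even] using h (2 * m)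
  have hq : q = q' := by
    ext m; simpa only [poleCoeff_odd] using h (2 * m + 3)
  rw [hp, hq]

lemma poleCoeff_natDegree_norm_ne_zero {r : W.CoordinateRing} (hr : r ≠ 0) :
    poleCoeff W (Algebra.norm K[X] r).natDegree r ≠ 0 := by
  intro h0
  have h := (natDegree_norm_le_iff r _).mp le_rfl
  rcases hn : (Algebra.norm K[X] r).natDegree with _ | n
  · rw [hn] at h h0
    refine hr (poleCoeff_ext fun i => ?_)
    rw [map_zero]
    rcases Nat.eq_zero_or_pos i with rfl | hi
    · exact h0
    · exact h i hi
  · have : (Algebra.norm K[X] r).natDegree ≤ n := by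
      rw [natDegree_norm_le_iff]
      intro i hi
      rcases (Nat.succ_le_of_lt hi).eq_or_lt with rfl | hi
      · rwa [hn] at h0
      · exact h i (by omega)
    omega

lemma algebraMap_mul_eq_smul (c : K) (r : W.CoordinateRing) :
    algebraMap K W.CoordinateRing c * r = c • r := (Algebra.smul_def c r).symm

/-- Cancel the leading coefficients: the graded pieces of the pole filtration have dimension at most
one. -/
lemma natDegree_norm_sub_lt {r s : W.CoordinateRing} (hs : s ≠ 0)
    (h : (Algebra.norm K[X] r).natDegree ≤ (Algebra.norm K[X] s).natDegree) :
    ∃ c : K, r - c • s = 0 ∨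
      (Algebra.norm K[X] (r - c • s)).natDegree < (Algebra.norm K[X] s).natDegree := by
  set n := (Algebra.norm K[X] s).natDegree with hn
  have hs0 : poleCoeff W n s ≠ 0 := poleCoeff_natDegree_norm_ne_zero hs
  refine ⟨poleCoeff W n r / poleCoeff W n s, ?_⟩
  set c := poleCoeff W n r / poleCoeff W n s with hc
  by_contra! H
  obtain ⟨H0, H1⟩ := H
  have h1 : (Algebra.norm K[X] (r - c • s)).natDegree ≤ n := by
    rw [natDegree_norm_le_iff] at h ⊢
    intro i hi
    rw [map_sub, map_smul, h i hi, (natDegree_norm_le_iff s n).mp hn.ge i hi]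
    simp
  have h2 := poleCoeff_natDegree_norm_ne_zero H0
  rw [le_antisymm h1 H1, map_sub, map_smul, hc, smul_eq_mul, div_mul_cancel₀ _ hs0, sub_self] at h2
  exact h2 rfl

/-- The element of pole order `i ≠ 1` of the standard basis of the coordinate ring. -/
def poleBasis (W : WeierstrassCurve.Affine K) (i : ℕ) : W.CoordinateRing :=
  if Even i then (X ^ (i / 2) : K[X]) • (1 : W.CoordinateRing) + (0 : K[X]) • mk W Y
  else (0 : K[X]) • (1 : W.CoordinateRing) + (X ^ ((i - 3) / 2) : K[X]) • mk W Y

/-- Index `1` is excluded because truncated subtraction makes `poleBasis W 1` equal to $Y$, the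
element of index `3`. -/
lemma poleCoeff_poleBasis {i : ℕ} (hi : i ≠ 1) (j : ℕ) :
    poleCoeff W j (poleBasis W i) = if j = i then 1 else 0 := by
  obtain ⟨m, rfl | rfl⟩ := Nat.even_or_odd' j
  · rw [poleBasis]
    split_ifs with h1 h2 h2
    · subst h2; rw [poleCoeff_even]; simp
    · rw [poleCoeff_even, coeff_X_pow, if_neg]; rintro rfl; grind
    · grind
    · rw [poleCoeff_even]; simp
  · rcases m with _ | m
    · rw [poleCoeff_one, if_neg (by omega)]
    rw [show 2 * (m + 1) + 1 = 2 * m + 3 by ring, poleBasis]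
    split_ifs with h1 h2 h2
    · grind
    · rw [poleCoeff_odd]; simp
    · subst h2; rw [poleCoeff_odd]; simp
    · rw [poleCoeff_odd, coeff_X_pow, if_neg]; rintro rfl; grind

end Infinity

/-! ### Valuation properties of the order on the coordinate ring. -/

section RingOrd

variable {K : Type*} [Field K] {W : WeierstrassCurve.Affine K}

open Affine.CoordinateRing

lemma ringOrd_zero (r : W.CoordinateRing) :
    ringOrd W 0 r = -((Algebra.norm K[X] r).natDegree : ℤ) := rfl

lemma norm_ne_zero {r : W.CoordinateRing} (hr : r ≠ 0) : Algebra.norm K[X] r ≠ 0 :=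
  (Algebra.norm_ne_zero_iff_of_basis (Affine.CoordinateRing.basis W)).mpr hr

lemma ringOrd_nonneg {P : W.Point} (hP : P ≠ 0) (r : W.CoordinateRing) : 0 ≤ ringOrd W P r := by
  rw [ringOrd_eq_sSup hP]; positivity

lemma isUnit_algebraMap {c : K} (hc : c ≠ 0) : IsUnit (algebraMap K W.CoordinateRing c) :=
  (IsUnit.mk0 c hc).map _

lemma exists_algebraMap_sub_mem {P : W.Point} (hP : P ≠ 0) (d : W.CoordinateRing) :
    ∃ c : K, d - algebraMap K W.CoordinateRing c ∈ pointIdeal P := by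
  cases P with
  | zero => exact (hP rfl).elim
  | some x y h =>
    let e := quotientXYIdealEquiv (W' := W) (x := x) (y := C y) h.1
    refine ⟨e (Ideal.Quotient.mk _ d), ?_⟩
    rw [pointIdeal, ← Ideal.Quotient.eq]
    apply e.injective
    exact (e.commutes _).symm

variable [IsAlgClosed K] [W.IsElliptic]

lemma le_ringOrd_iff {P : W.Point} (hP : P ≠ 0) {r : W.CoordinateRing} (hr : r ≠ 0) (n : ℕ) :
    (n : ℤ) ≤ ringOrd W P r ↔ r ∈ pointIdeal P ^ n := by
  classical
  obtain ⟨s, hs, hsr, hord, -, -⟩ := exists_zeros hr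
  rw [hord P hP, mem_pointIdeal_pow_iff hs hsr hP, Nat.cast_le]

lemma ringOrd_mul (P : W.Point) {r s : W.CoordinateRing} (hr : r ≠ 0) (hs : s ≠ 0) :
    ringOrd W P (r * s) = ringOrd W P r + ringOrd W P s := by
  classical
  by_cases hP : P = 0
  · subst hP
    rw [ringOrd_zero, ringOrd_zero, ringOrd_zero, map_mul,
      natDegree_mul (norm_ne_zero hr) (norm_ne_zero hs)]
    push_cast; ring
  obtain ⟨a, ha, har, hao, -, -⟩ := exists_zeros hr
  obtain ⟨b, hb, hbs, hbo, -, -⟩ := exists_zeros hs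
  rw [hao P hP, hbo P hP, ringOrd_eq_sSup hP, ← Nat.cast_add, ← Multiset.count_add]
  have hab : ((a + b).map pointIdeal).prod = Ideal.span {r * s} := by
    rw [Multiset.map_add, Multiset.prod_add, har, hbs, Ideal.span_singleton_mul_span_singleton]
  have hab0 : ∀ P ∈ a + b, P ≠ 0 := fun Q hQ =>
    (Multiset.mem_add.mp hQ).elim (ha Q) (hb Q)
  simp_rw [mem_pointIdeal_pow_iff hab0 hab hP]
  exact congrArg _ (csSup_Iic (a := (a + b).count P))

lemma ringOrd_add (P : W.Point) {r s : W.CoordinateRing} (hr : r ≠ 0) (hs : s ≠ 0)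
    (hrs : r + s ≠ 0) : min (ringOrd W P r) (ringOrd W P s) ≤ ringOrd W P (r + s) := by
  by_cases hP : P = 0
  · subst hP
    simp only [ringOrd_zero]
    rw [min_neg_neg, neg_le_neg_iff, ← Nat.cast_max, Nat.cast_le, natDegree_norm_le_iff]
    intro i hi
    rw [map_add, (natDegree_norm_le_iff r _).mp (le_max_left _ _) i hi,
      (natDegree_norm_le_iff s _).mp (le_max_right _ _) i hi, add_zero]
  · obtain ⟨n, hn⟩ := Int.eq_ofNat_of_zero_le
      (le_min (ringOrd_nonneg hP r) (ringOrd_nonneg hP s))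
    have h1 := hn.symm.le.trans (min_le_left _ _)
    have h2 := hn.symm.le.trans (min_le_right _ _)
    rw [hn, le_ringOrd_iff hP hrs]
    exact Ideal.add_mem _ ((le_ringOrd_iff hP hr n).mp h1) ((le_ringOrd_iff hP hs n).mp h2)

/-- The orders of a unit and its inverse add up to zero, yet have the same sign: nonnegative at
affine points, nonpositive at infinity. -/
lemma ringOrd_of_isUnit (P : W.Point) {r : W.CoordinateRing} (hr : IsUnit r) :
    ringOrd W P r = 0 := by
  obtain ⟨s, hs⟩ := hr.exists_right_inv
  have hr0 : r ≠ 0 := hr.ne_zero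
  have hs0 : s ≠ 0 := fun h => by simp [h] at hs
  have h1 : ringOrd W P 1 = 0 := by
    have := ringOrd_mul P (one_ne_zero (α := W.CoordinateRing)) one_ne_zero
    rw [mul_one] at this
    omega
  have h2 := ringOrd_mul P hr0 hs0
  rw [hs, h1] at h2
  by_cases hP : P = 0
  · subst hP
    simp only [ringOrd_zero] at h2 ⊢
    omega
  · have := ringOrd_nonneg hP r
    have := ringOrd_nonneg hP s
    omega

lemma ringOrd_smul (P : W.Point) {c : K} (hc : c ≠ 0) {r : W.CoordinateRing} (hr : r ≠ 0) :
    ringOrd W P (c • r) = ringOrd W P r := by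
  rw [← algebraMap_mul_eq_smul, ringOrd_mul P (isUnit_algebraMap hc).ne_zero hr,
    ringOrd_of_isUnit P (isUnit_algebraMap hc), zero_add]

/-- The residue field at every point is $K$. At an affine point, `r` is a multiple of `s` modulo the
next power of the point ideal, and the multiplier may be replaced by its residue. -/
lemma exists_value (P : W.Point) {r s : W.CoordinateRing} (hr : r ≠ 0) (hs : s ≠ 0)
    (h : ringOrd W P s ≤ ringOrd W P r) :
    ∃ c : K, r - c • s = 0 ∨ ringOrd W P s < ringOrd W P (r - c • s) := by
  by_cases hP : P = 0
  · subst hP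
    obtain ⟨c, hc⟩ := natDegree_norm_sub_lt (r := r) hs (by simpa [ringOrd_zero] using h)
    exact ⟨c, hc.imp_right fun h => by simpa [ringOrd_zero] using h⟩
  obtain ⟨n, hn⟩ := Int.eq_ofNat_of_zero_le (ringOrd_nonneg hP s)
  have := pointIdeal_isMaximal hP
  have hsn := (le_ringOrd_iff hP hs n).mp hn.ge
  have hsn' : s ∉ pointIdeal P ^ (n + 1) := by
    rw [← le_ringOrd_iff hP hs]; push_cast; omega
  have hrn := (le_ringOrd_iff hP hr n).mp (hn.ge.trans h)
  obtain ⟨d, e, he, hde⟩ := Ideal.exists_mul_add_mem_pow_succ (pointIdeal_ne_bot P)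
    s r hsn hsn' hrn
  obtain ⟨c, hc⟩ := exists_algebraMap_sub_mem hP d
  refine ⟨c, ?_⟩
  by_cases h0 : r - c • s = 0
  · exact .inl h0
  right
  rw [hn, ← Order.add_one_le_iff]
  refine (le_ringOrd_iff hP h0 (n + 1)).mpr ?_
  have : r - c • s = s * (d - algebraMap K W.CoordinateRing c) + e := by
    rw [← hde, ← algebraMap_mul_eq_smul]; ring
  rw [this, pow_succ]
  exact Ideal.add_mem _ (Ideal.mul_mem_mul hsn hc) (by rwa [← pow_succ])

end RingOrd


/-! ### Degree and sum of divisors. -/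

section Divisors

variable {K : Type*} [Field K] {W : WeierstrassCurve.Affine K}

/-- The degree of a divisor. -/
def degHom (W : WeierstrassCurve.Affine K) : (W.Point →₀ ℤ) →+ ℤ :=
  Finsupp.liftAddHom fun _ => AddMonoidHom.id ℤ

@[simp]
lemma degHom_single (P : W.Point) (n : ℤ) : degHom W (Finsupp.single P n) = n := by
  simp [degHom]

/-- The sum of a divisor in the group of points. -/
def sumHom (W : WeierstrassCurve.Affine K) [DecidableEq K] : (W.Point →₀ ℤ) →+ W.Point :=
  Finsupp.liftAddHom fun Q => (zmultiplesHom W.Point) Q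

@[simp]
lemma sumHom_single [DecidableEq K] (P : W.Point) (n : ℤ) :
    sumHom W (Finsupp.single P n) = n • P := by
  simp [sumHom]

lemma eq_of_le_of_degHom_eq {δ ε : W.Point →₀ ℤ} (h : ∀ P, δ P ≤ ε P)
    (hdeg : degHom W δ = degHom W ε) : δ = ε := by
  have h0 : ∀ P, 0 ≤ (ε - δ) P := fun P => by
    rw [Finsupp.sub_apply]; exact sub_nonneg.mpr (h P)
  have h1 : degHom W (ε - δ) = 0 := by rw [map_sub, hdeg, sub_self]
  have h2 : degHom W (ε - δ) = ∑ P ∈ (ε - δ).support, (ε - δ) P := by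
    simp [degHom, Finsupp.liftAddHom_apply, Finsupp.sum]
  rw [h2, Finset.sum_eq_zero_iff_of_nonneg fun P _ => h0 P] at h1
  ext P
  by_contra hne
  have : (ε - δ) P ≠ 0 := by rw [Finsupp.sub_apply]; exact sub_ne_zero.mpr (Ne.symm hne)
  exact this (h1 P (Finsupp.mem_support_iff.mpr this))

/-- The effective divisor of a multiset of points. -/
def multisetDivisor (s : Multiset W.Point) : W.Point →₀ ℤ :=
  (s.map fun P => Finsupp.single P 1).sum

lemma multisetDivisor_apply [DecidableEq W.Point] (s : Multiset W.Point) (P : W.Point) :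
    multisetDivisor s P = s.count P := by
  induction s using Multiset.induction_on with
  | empty => simp [multisetDivisor]
  | cons a s ih =>
    rw [multisetDivisor, Multiset.map_cons, Multiset.sum_cons, Finsupp.add_apply,
      ← multisetDivisor, ih, Multiset.count_cons, Finsupp.single_apply]
    push_cast
    simp only [eq_comm, add_comm]

lemma degHom_multisetDivisor (s : Multiset W.Point) : degHom W (multisetDivisor s) = s.card := by
  simp [multisetDivisor, map_multiset_sum]

lemma sumHom_multisetDivisor [DecidableEq K] (s : Multiset W.Point) :
    sumHom W (multisetDivisor s) = s.sum := by
  simp [multisetDivisor, map_multiset_sum]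

end Divisors

/-! ### Valuations and principal divisors on the function field. -/

section Ord

variable {K : Type*} [Field K] [IsAlgClosed K] {W : WeierstrassCurve.Affine K} [W.IsElliptic]

lemma ringOrd_eq_of_prod {s : Multiset W.Point} (hs : ∀ P ∈ s, P ≠ 0)
    {r : W.CoordinateRing} (hr : (s.map pointIdeal).prod = Ideal.span {r}) (P : W.Point) :
    ringOrd W P r = (multisetDivisor s - Finsupp.single 0 (s.card : ℤ) : W.Point →₀ ℤ) P := by
  classical
  rw [Finsupp.sub_apply, multisetDivisor_apply]
  by_cases hP : P = 0
  · subst hP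
    rw [Finsupp.single_eq_same, ringOrd_zero, natDegree_norm_eq_card hs hr,
      Multiset.count_eq_zero_of_notMem fun h => hs 0 h rfl]
    simp
  · rw [Finsupp.single_eq_of_ne hP, sub_zero, ringOrd_eq_sSup hP]
    simp_rw [mem_pointIdeal_pow_iff hs hr hP]
    exact congrArg _ (csSup_Iic (a := s.count P))

lemma exists_ringDivisor [DecidableEq K] {r : W.CoordinateRing} (hr : r ≠ 0) :
    ∃ δ : W.Point →₀ ℤ, (∀ P, ringOrd W P r = δ P) ∧ degHom W δ = 0 ∧ sumHom W δ = 0 := by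
  obtain ⟨s, hs, hsr, -, -, hsum⟩ := exists_zeros hr
  refine ⟨_, ringOrd_eq_of_prod hs hsr, ?_, ?_⟩
  · rw [map_sub, degHom_multisetDivisor, degHom_single, sub_self]
  · rw [map_sub, sumHom_multisetDivisor, hsum, sumHom_single, smul_zero, sub_zero]

lemma exists_eq_div {A L : Type*} [CommRing A] [IsDomain A] [Field L] [Algebra A L]
    [IsFractionRing A L] {f : L} (hf : f ≠ 0) :
    ∃ r s : A, r ≠ 0 ∧ s ≠ 0 ∧ f = algebraMap A L r / algebraMap A L s := by
  obtain ⟨r, s, hs, rfl⟩ := IsFractionRing.div_surjective (A := A) f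
  exact ⟨r, s, fun h => hf (by simp [h]), nonZeroDivisors.ne_zero hs, rfl⟩

/-- `ord` is defined through the fraction chosen by `IsLocalization.sec`; additivity of `ringOrd`
makes it independent of that choice. -/
lemma ord_div (P : W.Point) {r s : W.CoordinateRing} (hr : r ≠ 0) (hs : s ≠ 0) :
    ord W P (algebraMap _ W.FunctionField r / algebraMap _ W.FunctionField s) =
      ringOrd W P r - ringOrd W P s := by
  set f := algebraMap _ W.FunctionField r / algebraMap _ W.FunctionField s with hf
  have hinj := IsFractionRing.injective W.CoordinateRing W.FunctionField
  have hs' : algebraMap _ W.FunctionField s ≠ 0 := by simpa using hs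
  have hr' : algebraMap _ W.FunctionField r ≠ 0 := by simpa using hr
  have hf0 : f ≠ 0 := div_ne_zero hr' hs'
  have hspec := IsLocalization.sec_spec W.CoordinateRing⁰ f
  set a := (IsLocalization.sec W.CoordinateRing⁰ f).1
  set b := (IsLocalization.sec W.CoordinateRing⁰ f).2
  have hb : (b : W.CoordinateRing) ≠ 0 := nonZeroDivisors.coe_ne_zero b
  have ha : a ≠ 0 := by
    intro h
    rw [h, map_zero] at hspec
    exact mul_ne_zero hf0 (by simp) hspec
  have h1 : a * s = r * b := by
    apply hinj
    rw [map_mul, map_mul, ← hspec, hf]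
    field_simp
  have h2 := ringOrd_mul P ha hs
  rw [h1, ringOrd_mul P hr hb] at h2
  change ringOrd W P a - ringOrd W P b = _
  linarith

lemma ord_algebraMap (P : W.Point) {r : W.CoordinateRing} (hr : r ≠ 0) :
    ord W P (algebraMap _ W.FunctionField r) = ringOrd W P r := by
  have := ord_div P hr (one_ne_zero (α := W.CoordinateRing))
  rwa [map_one, div_one, ringOrd_of_isUnit P isUnit_one, sub_zero] at this

lemma ord_mul (P : W.Point) {f g : W.FunctionField} (hf : f ≠ 0) (hg : g ≠ 0) :
    ord W P (f * g) = ord W P f + ord W P g := by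
  obtain ⟨a, b, ha, hb, rfl⟩ := exists_eq_div (A := W.CoordinateRing) hf
  obtain ⟨c, d, hc, hd, rfl⟩ := exists_eq_div (A := W.CoordinateRing) hg
  rw [div_mul_div_comm, ← map_mul, ← map_mul, ord_div P (mul_ne_zero ha hc) (mul_ne_zero hb hd),
    ord_div P ha hb, ord_div P hc hd, ringOrd_mul P ha hc, ringOrd_mul P hb hd]
  ring

lemma ord_one (P : W.Point) : ord W P (1 : W.FunctionField) = 0 := by
  rw [← map_one (algebraMap W.CoordinateRing W.FunctionField), ord_algebraMap P one_ne_zero,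
    ringOrd_of_isUnit P isUnit_one]

lemma ord_inv (P : W.Point) {f : W.FunctionField} (hf : f ≠ 0) :
    ord W P f⁻¹ = -ord W P f := by
  have := ord_mul P hf (inv_ne_zero hf)
  rw [mul_inv_cancel₀ hf, ord_one] at this
  linarith

lemma exists_common_denom {A L : Type*} [CommRing A] [IsDomain A] [Field L] [Algebra A L]
    [IsFractionRing A L] {f g : L} (hf : f ≠ 0) (hg : g ≠ 0) :
    ∃ r s t : A, r ≠ 0 ∧ s ≠ 0 ∧ t ≠ 0 ∧ f = algebraMap A L r / algebraMap A L t ∧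
      g = algebraMap A L s / algebraMap A L t := by
  obtain ⟨a, b, ha, hb, rfl⟩ := exists_eq_div (A := A) hf
  obtain ⟨c, d, hc, hd, rfl⟩ := exists_eq_div (A := A) hg
  have hb' : algebraMap A L b ≠ 0 := by simpa using hb
  have hd' : algebraMap A L d ≠ 0 := by simpa using hd
  refine ⟨a * d, c * b, b * d, mul_ne_zero ha hd, mul_ne_zero hc hb, mul_ne_zero hb hd, ?_, ?_⟩
  · rw [map_mul, map_mul]; field_simp
  · rw [map_mul, map_mul]; field_simp

/-- The alternatives `_ = 0` stand in for an infinite order at zero, since `ord` is integer-valued.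
-/
lemma ord_add (P : W.Point) {f g : W.FunctionField} {n : ℤ} (hf : f = 0 ∨ n ≤ ord W P f)
    (hg : g = 0 ∨ n ≤ ord W P g) : f + g = 0 ∨ n ≤ ord W P (f + g) := by
  by_cases hf0 : f = 0
  · simpa [hf0] using hg
  by_cases hg0 : g = 0
  · simpa [hg0] using hf
  by_cases hfg : f + g = 0
  · exact .inl hfg
  right
  replace hf := hf.resolve_left hf0
  replace hg := hg.resolve_left hg0
  obtain ⟨r, s, t, hr, hs, ht, rfl, rfl⟩ := exists_common_denom (A := W.CoordinateRing) hf0 hg0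
  rw [← add_div, ← map_add] at hfg ⊢
  have hrs : r + s ≠ 0 := fun h => hfg (by simp [h])
  rw [ord_div P hr ht] at hf
  rw [ord_div P hs ht] at hg
  rw [ord_div P hrs ht]
  have := ringOrd_add P hr hs hrs
  omega

lemma ord_algebraMap_of_ne_zero (P : W.Point) {c : K} (hc : c ≠ 0) :
    ord W P (algebraMap K W.FunctionField c) = 0 := by
  rw [IsScalarTower.algebraMap_apply K W.CoordinateRing W.FunctionField,
    ord_algebraMap P (isUnit_algebraMap hc).ne_zero, ringOrd_of_isUnit P (isUnit_algebraMap hc)]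

lemma exists_divisor [DecidableEq K] {f : W.FunctionField} (hf : f ≠ 0) :
    ∃ δ : W.Point →₀ ℤ, (∀ P, ord W P f = δ P) ∧ degHom W δ = 0 ∧ sumHom W δ = 0 := by
  obtain ⟨r, s, hr, hs, rfl⟩ := exists_eq_div (A := W.CoordinateRing) hf
  obtain ⟨δ, hδ, hδd, hδs⟩ := exists_ringDivisor hr
  obtain ⟨ε, hε, hεd, hεs⟩ := exists_ringDivisor hs
  refine ⟨δ - ε, fun P => ?_, ?_, ?_⟩
  · rw [ord_div P hr hs, hδ, hε, Finsupp.sub_apply]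
  · rw [map_sub, hδd, hεd, sub_self]
  · rw [map_sub, hδs, hεs, sub_self]

end Ord


/-! ### Base change, Galois action and descent. -/

section Galois

universe u v

variable {F : Type u} [Field F] {E : WeierstrassCurve F} {K : Type v} [Field K] [Algebra F K]

open Affine.CoordinateRing

/-- The inclusion of the coordinate ring of `E` into that of its base change. -/
def ringMap (E : WeierstrassCurve F) (K : Type v) [Field K] [Algebra F K] :
    E.toAffine.CoordinateRing →+* (E.baseChange K).toAffine.CoordinateRing :=
  Affine.CoordinateRing.map E.toAffine (algebraMap F K)

lemma ringMap_injective : Function.Injective (ringMap E K) :=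
  Affine.CoordinateRing.map_injective (algebraMap F K).injective

lemma ringMap_mk (x : F[X][Y]) : ringMap E K (mk E.toAffine x) =
    mk (E.baseChange K).toAffine (x.map (mapRingHom (algebraMap F K))) :=
  Affine.CoordinateRing.map_mk _ _

lemma ringMap_smul_basis (p q : F[X]) :
    ringMap E K (p • (1 : E.toAffine.CoordinateRing) + q • mk E.toAffine Y) =
      p.map (algebraMap F K) • (1 : (E.baseChange K).toAffine.CoordinateRing) +
        q.map (algebraMap F K) • mk (E.baseChange K).toAffine Y := by
  simp only [Affine.CoordinateRing.smul, map_add, map_mul, ringMap_mk, map_C, coe_mapRingHom,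
    map_X, mul_one]

lemma poleCoeff_ringMap (r : E.toAffine.CoordinateRing) (i : ℕ) :
    poleCoeff (E.baseChange K).toAffine i (ringMap E K r) =
      algebraMap F K (poleCoeff E.toAffine i r) := by
  obtain ⟨p, q, rfl⟩ := exists_smul_basis_eq r
  rw [ringMap_smul_basis]
  obtain ⟨m, rfl | rfl⟩ := Nat.even_or_odd' i
  · rw [poleCoeff_even, poleCoeff_even, coeff_map]
  · rcases m with _ | m
    · rw [Nat.mul_zero, zero_add, poleCoeff_one, poleCoeff_one, map_zero]
    · rw [show 2 * (m + 1) + 1 = 2 * m + 3 by ring, poleCoeff_odd, poleCoeff_odd, coeff_map]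

lemma ringMap_smul (c : F) (r : E.toAffine.CoordinateRing) :
    ringMap E K (c • r) = algebraMap F K c • ringMap E K r :=
  poleCoeff_ext fun i => by
    rw [poleCoeff_ringMap, LinearMap.map_smul, LinearMap.map_smul, poleCoeff_ringMap, smul_eq_mul, map_mul, smul_eq_mul]

variable (E) in
/-- The action of a Galois automorphism on the coordinate ring of the base change. -/
def conj (σ : K ≃ₐ[F] K) :
    (E.baseChange K).toAffine.CoordinateRing →+* (E.baseChange K).toAffine.CoordinateRing :=
  AdjoinRoot.lift ((AdjoinRoot.of _).comp <| mapRingHom (σ : K →+* K))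
    (AdjoinRoot.root (E.baseChange K).toAffine.polynomial) (by
      -- The equation of the curve has coefficients in `F`, so `σ` fixes it.
      have h : ((E.baseChange K).toAffine.polynomial).map (mapRingHom (σ : K →+* K)) =
          (E.baseChange K).toAffine.polynomial := by
        rw [← Affine.map_polynomial]
        congr 1
        exact (E.map_baseChange (S := F) (σ : K →ₐ[F] K))
      rw [← eval₂_map, h, AdjoinRoot.eval₂_root])

lemma conj_mk (σ : K ≃ₐ[F] K) (x : K[X][Y]) :
    conj E σ (mk (E.baseChange K).toAffine x) =
      mk (E.baseChange K).toAffine (x.map (mapRingHom (σ : K →+* K))) := by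
  rw [conj, AdjoinRoot.lift_mk, ← eval₂_map]
  exact AdjoinRoot.aeval_eq _

lemma conj_smul_basis (σ : K ≃ₐ[F] K) (p q : K[X]) :
    conj E σ (p • (1 : (E.baseChange K).toAffine.CoordinateRing) +
      q • mk (E.baseChange K).toAffine Y) =
      p.map (σ : K →+* K) • (1 : (E.baseChange K).toAffine.CoordinateRing) +
        q.map (σ : K →+* K) • mk (E.baseChange K).toAffine Y := by
  simp only [Affine.CoordinateRing.smul, map_add, map_mul, conj_mk, map_C, coe_mapRingHom, map_X,
    mul_one]

lemma poleCoeff_conj (σ : K ≃ₐ[F] K) (r : (E.baseChange K).toAffine.CoordinateRing) (i : ℕ) :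
    poleCoeff (E.baseChange K).toAffine i (conj E σ r) =
      σ (poleCoeff (E.baseChange K).toAffine i r) := by
  obtain ⟨p, q, rfl⟩ := exists_smul_basis_eq r
  rw [conj_smul_basis]
  obtain ⟨m, rfl | rfl⟩ := Nat.even_or_odd' i
  · rw [poleCoeff_even, poleCoeff_even, coeff_map]; rfl
  · rcases m with _ | m
    · rw [Nat.mul_zero, zero_add, poleCoeff_one, poleCoeff_one, map_zero]
    · rw [show 2 * (m + 1) + 1 = 2 * m + 3 by ring, poleCoeff_odd, poleCoeff_odd, coeff_map]; rfl

lemma conj_ringMap (σ : K ≃ₐ[F] K) (r : E.toAffine.CoordinateRing) :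
    conj E σ (ringMap E K r) = ringMap E K r :=
  poleCoeff_ext fun i => by rw [poleCoeff_conj, poleCoeff_ringMap, σ.commutes]

lemma conj_smul (σ : K ≃ₐ[F] K) (c : K) (r : (E.baseChange K).toAffine.CoordinateRing) :
    conj E σ (c • r) = σ c • conj E σ r :=
  poleCoeff_ext fun i => by
    rw [poleCoeff_conj, LinearMap.map_smul, LinearMap.map_smul, poleCoeff_conj, smul_eq_mul, map_mul, smul_eq_mul]

lemma conj_symm_conj (σ : K ≃ₐ[F] K) (r : (E.baseChange K).toAffine.CoordinateRing) :
    conj E σ.symm (conj E σ r) = r :=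
  poleCoeff_ext fun i => by rw [poleCoeff_conj, poleCoeff_conj, σ.symm_apply_apply]

lemma conj_injective (σ : K ≃ₐ[F] K) : Function.Injective (conj E σ) :=
  Function.LeftInverse.injective (conj_symm_conj σ)

/-- Conjugation acts coefficientwise in the basis $1$, $Y$ over $K[X]$, so a fixed function has all
its coefficients in `F`. -/
lemma mem_range_ringMap [IsGalois F K] (r : (E.baseChange K).toAffine.CoordinateRing)
    (h : ∀ σ : K ≃ₐ[F] K, conj E σ r = r) : ∃ r₀, ringMap E K r₀ = r := by
  have hc : ∀ i, ∃ a : F, algebraMap F K a = poleCoeff (E.baseChange K).toAffine i r := fun i =>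
    (InfiniteGalois.mem_range_algebraMap_iff_fixed _).mpr fun σ => by
      have := poleCoeff_conj σ r i
      rw [h σ] at this
      exact this.symm
  obtain ⟨p, q, rfl⟩ := exists_smul_basis_eq r
  have hp : p ∈ Polynomial.lifts (algebraMap F K) := by
    rw [Polynomial.lifts_iff_coeff_lifts]
    intro m
    have := hc (2 * m)
    rwa [poleCoeff_even] at this
  have hq : q ∈ Polynomial.lifts (algebraMap F K) := by
    rw [Polynomial.lifts_iff_coeff_lifts]
    intro m
    have := hc (2 * m + 3)
    rwa [poleCoeff_odd] at this
  obtain ⟨p, rfl⟩ := hp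
  obtain ⟨q, rfl⟩ := hq
  exact ⟨_, ringMap_smul_basis p q⟩

variable [DecidableEq K]

/-- The action of a Galois automorphism on points. -/
def galMap (σ : K ≃ₐ[F] K) : Pts E K →+ Pts E K :=
  Affine.Point.map (W' := E) (σ : K →ₐ[F] K)

/-- The inclusion of the rational points. -/
def incl [DecidableEq F] : Pts E F →+ Pts E K :=
  Affine.Point.baseChange (W' := E) F K

lemma galMap_injective (σ : K ≃ₐ[F] K) : Function.Injective (galMap (E := E) σ) :=
  Affine.Point.map_injective (W' := E) (σ : K →ₐ[F] K)

lemma incl_injective [DecidableEq F] : Function.Injective (incl (E := E) (K := K)) :=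
  Affine.Point.map_injective (W' := E) (Algebra.ofId F K)

lemma map_conj_pointIdeal (σ : K ≃ₐ[F] K) (Q : Pts E K) :
    (pointIdeal Q).map (conj E σ) =
      pointIdeal (galMap σ Q) := by
  cases Q with
  | zero => exact Ideal.map_top _
  | some x y h =>
    rw [galMap, Affine.Point.map_some, pointIdeal, pointIdeal, XYIdeal, XYIdeal, Ideal.map_span,
      Set.image_pair, XClass, XClass, YClass, YClass, conj_mk, conj_mk]
    simp

lemma galMap_symm_galMap (σ : K ≃ₐ[F] K) (Q : Pts E K) :
    galMap σ.symm (galMap σ Q) = Q := by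
  cases Q with
  | zero => rfl
  | some x y h => simp [galMap, Affine.Point.map_some]

lemma galMap_incl [DecidableEq F] (σ : K ≃ₐ[F] K) (P : Pts E F) :
    galMap σ (incl P : Pts E K) = incl P :=
  Affine.Point.map_baseChange (W' := E) _ P

instance [E.IsElliptic] : WeierstrassCurve.IsElliptic (E.baseChange K).toAffine :=
  inferInstanceAs (E.map (algebraMap F K)).IsElliptic

variable [IsAlgClosed K] [E.IsElliptic]

/-- Only an inequality is proved here; applying it to `σ` and to its inverse gives equality. -/
lemma ringOrd_conj_le (σ : K ≃ₐ[F] K) (Q : Pts E K)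
    {r : (E.baseChange K).toAffine.CoordinateRing} (hr : r ≠ 0) :
    ringOrd (E.baseChange K).toAffine Q r ≤ ringOrd (E.baseChange K).toAffine (galMap σ Q) (conj E σ r) := by
  have hr' : conj E σ r ≠ 0 := (map_ne_zero_iff _ (conj_injective σ)).mpr hr
  by_cases hQ : Q = 0
  · subst hQ
    rw [map_zero, ringOrd_zero, ringOrd_zero, neg_le_neg_iff, Nat.cast_le, natDegree_norm_le_iff]
    intro i hi
    rw [poleCoeff_conj, (natDegree_norm_le_iff r _).mp le_rfl i hi, map_zero]
  · have hQ' : galMap σ Q ≠ 0 :=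
      (map_ne_zero_iff _ (galMap_injective σ)).mpr hQ
    obtain ⟨n, hn⟩ := Int.eq_ofNat_of_zero_le (ringOrd_nonneg hQ r)
    rw [hn, le_ringOrd_iff hQ' hr', ← map_conj_pointIdeal, ← Ideal.map_pow]
    exact Ideal.mem_map_of_mem _ ((le_ringOrd_iff hQ hr n).mp hn.ge)

lemma ringOrd_conj (σ : K ≃ₐ[F] K) (Q : Pts E K)
    {r : (E.baseChange K).toAffine.CoordinateRing} (hr : r ≠ 0) :
    ringOrd (E.baseChange K).toAffine (galMap σ Q) (conj E σ r) = ringOrd (E.baseChange K).toAffine Q r := by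
  refine le_antisymm ?_ (ringOrd_conj_le σ Q hr)
  have := ringOrd_conj_le σ.symm (galMap σ Q)
    ((map_ne_zero_iff _ (conj_injective σ)).mpr hr)
  rwa [conj_symm_conj, galMap_symm_galMap] at this

/-- The constant over `K` is unique. If `σ` moved it, subtracting the conjugate relation, valid at
the same point because `P` is rational, would give a nonzero multiple of `s` an order larger than
that of `s`. -/
lemma exists_value_rational [DecidableEq F] [IsGalois F K] (P : Pts E F)
    {r s : E.toAffine.CoordinateRing} (hr : r ≠ 0) (hs : s ≠ 0)
    (h : ringOrd (E.baseChange K).toAffine (incl P) (ringMap E K s) ≤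
      ringOrd (E.baseChange K).toAffine (incl P) (ringMap E K r)) :
    ∃ c : F, r - c • s = 0 ∨
      ringOrd (E.baseChange K).toAffine (incl P) (ringMap E K s) <
      ringOrd (E.baseChange K).toAffine (incl P) (ringMap E K (r - c • s)) := by
  set P' : Pts E K := incl P with hP'
  have hr' : ringMap E K r ≠ 0 := (map_ne_zero_iff _ ringMap_injective).mpr hr
  have hs' : ringMap E K s ≠ 0 := (map_ne_zero_iff _ ringMap_injective).mpr hs
  obtain ⟨c, hc⟩ := exists_value P' hr' hs' h
  have hfix : ∀ σ : K ≃ₐ[F] K, σ c = c := by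
    intro σ
    by_contra hne
    have hsub : c - σ c ≠ 0 := sub_ne_zero.mpr (Ne.symm hne)
    have hconj : conj E σ (ringMap E K r - c • ringMap E K s) =
        ringMap E K r - σ c • ringMap E K s := by
      rw [map_sub, conj_smul, conj_ringMap, conj_ringMap]
    have hdiff : (ringMap E K r - σ c • ringMap E K s) + -(ringMap E K r - c • ringMap E K s) =
        (c - σ c) • ringMap E K s := by
      rw [sub_smul]; ring
    have hd0 : (c - σ c) • ringMap E K s ≠ 0 := smul_ne_zero hsub hs'
    by_cases h0 : ringMap E K r - c • ringMap E K s = 0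
    · rw [h0, map_zero] at hconj
      rw [← hconj, h0, neg_zero, add_zero] at hdiff
      exact hd0 hdiff.symm
    · have hlt := hc.resolve_left h0
      have h1 := ringOrd_conj σ P' h0
      rw [hP', galMap_incl, ← hP', hconj] at h1
      have h0' : ringMap E K r - σ c • ringMap E K s ≠ 0 := by
        rw [← hconj]; exact (map_ne_zero_iff _ (conj_injective σ)).mpr h0
      have h2 : ringOrd (E.baseChange K).toAffine P' (-(ringMap E K r - c • ringMap E K s)) =
          ringOrd (E.baseChange K).toAffine P' (ringMap E K r - c • ringMap E K s) := by
        rw [← neg_one_smul K, ringOrd_smul P' (neg_ne_zero.mpr one_ne_zero) h0]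
      have h3 := ringOrd_add P' h0' (neg_ne_zero.mpr h0) (by rw [hdiff]; exact hd0)
      rw [hdiff, ringOrd_smul P' hsub hs', h2, h1, min_self] at h3
      omega
  obtain ⟨a, rfl⟩ := (InfiniteGalois.mem_range_algebraMap_iff_fixed c).mpr hfix
  refine ⟨a, ?_⟩
  rw [← ringMap_smul, ← map_sub] at hc
  exact hc.imp_left fun h => (map_eq_zero_iff _ ringMap_injective).mp h

end Galois


/-! ### Riemann-Roch spaces over the base field. -/

section RiemannRoch

universe u v

variable {F : Type u} [Field F] {E : WeierstrassCurve F} {K : Type v} [Field K] [Algebra F K]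

open Affine.CoordinateRing

lemma funMap_algebraMap (r : E.toAffine.CoordinateRing) :
    funMap E K (algebraMap _ E.toAffine.FunctionField r) =
      algebraMap _ (E.baseChange K).toAffine.FunctionField (ringMap E K r) := by
  unfold funMap IsFractionRing.map
  apply IsLocalization.map_eq

lemma funMap_ne_zero {f : E.toAffine.FunctionField} (hf : f ≠ 0) : funMap E K f ≠ 0 :=
  (map_ne_zero_iff _ (funMap E K).injective).mpr hf

lemma funMap_algebraMap_base (c : F) :
    funMap E K (algebraMap F E.toAffine.FunctionField c) =
      algebraMap K (E.baseChange K).toAffine.FunctionField (algebraMap F K c) := by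
  rw [IsScalarTower.algebraMap_apply F E.toAffine.CoordinateRing E.toAffine.FunctionField,
    funMap_algebraMap, Algebra.algebraMap_eq_smul_one (A := E.toAffine.CoordinateRing), ringMap_smul, map_one,
    ← Algebra.algebraMap_eq_smul_one, ← IsScalarTower.algebraMap_apply]

variable [IsAlgClosed K] [E.IsElliptic]

lemma ord_funMap_smul (Q : Pts E K) {c : F} (hc : c ≠ 0) {f : E.toAffine.FunctionField}
    (hf : f ≠ 0) :
    ord (E.baseChange K).toAffine Q (funMap E K (c • f)) =
      ord (E.baseChange K).toAffine Q (funMap E K f) := by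
  have hc' : algebraMap F K c ≠ 0 := (map_ne_zero_iff _ (algebraMap F K).injective).mpr hc
  rw [Algebra.smul_def, map_mul, funMap_algebraMap_base, ord_mul Q _ (funMap_ne_zero hf),
    ord_algebraMap_of_ne_zero Q hc', zero_add]
  exact (map_ne_zero_iff _ (algebraMap K _).injective).mpr hc'

lemma ord_funMap_add (Q : Pts E K) {f g : E.toAffine.FunctionField} {n : ℤ}
    (hf : f = 0 ∨ n ≤ ord (E.baseChange K).toAffine Q (funMap E K f))
    (hg : g = 0 ∨ n ≤ ord (E.baseChange K).toAffine Q (funMap E K g)) :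
    f + g = 0 ∨ n ≤ ord (E.baseChange K).toAffine Q (funMap E K (f + g)) := by
  have h0 : ∀ f : E.toAffine.FunctionField, f = 0 ↔ funMap E K f = 0 := fun f =>
    (map_eq_zero_iff _ (funMap E K).injective).symm
  rw [h0] at hf hg ⊢
  rw [map_add]
  exact ord_add Q hf hg

/-- The Riemann-Roch space as a vector space over the field of definition. -/
def rrSpace (G : Divisor E K) : Submodule F E.toAffine.FunctionField where
  carrier := riemannRoch G
  zero_mem' := .inl rfl
  add_mem' := by
    intro f g hf hg
    by_cases h0 : f + g = 0
    · exact .inl h0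
    refine .inr fun Q => ?_
    have := (ord_funMap_add Q (n := -G Q) (hf.imp_right fun h => by linarith [h Q])
      (hg.imp_right fun h => by linarith [h Q])).resolve_left h0
    linarith
  smul_mem' := by
    intro c f hf
    by_cases hc : c = 0
    · exact .inl (by rw [hc, zero_smul])
    by_cases hf0 : f = 0
    · exact .inl (by rw [hf0, smul_zero])
    refine .inr fun Q => ?_
    rw [ord_funMap_smul Q hc hf0]
    exact hf.resolve_left hf0 Q

lemma mem_rrSpace {G : Divisor E K} {f : E.toAffine.FunctionField} (hf : f ≠ 0) :
    f ∈ rrSpace G ↔ ∀ Q : Pts E K, 0 ≤ ord (E.baseChange K).toAffine Q (funMap E K f) + G Q :=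
  or_iff_right hf

/-- Multiplication by `q` embeds one space in the other. Ranks are cardinals because
finite-dimensionality of these spaces is not established beforehand and only lower bounds are
needed. -/
lemma rank_rrSpace_add_le {q : E.toAffine.FunctionField} (hq : q ≠ 0) {δ : Divisor E K}
    (hδ : ∀ Q, ord (E.baseChange K).toAffine Q (funMap E K q) = δ Q) (G : Divisor E K) :
    Module.rank F (rrSpace (G + δ)) ≤ Module.rank F (rrSpace G) := by
  have hmem : ∀ f ∈ rrSpace (G + δ), LinearMap.mulLeft F q f ∈ rrSpace G := by
    intro f hf
    by_cases hf0 : f = 0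
    · rw [hf0, map_zero]; exact zero_mem _
    rw [mem_rrSpace hf0] at hf
    rw [LinearMap.mulLeft_apply, mem_rrSpace (mul_ne_zero hq hf0)]
    intro Q
    have := hf Q
    rw [Finsupp.add_apply] at this
    rw [map_mul, ord_mul Q (funMap_ne_zero hq) (funMap_ne_zero hf0), hδ]
    linarith
  refine LinearMap.rank_le_of_injective ((LinearMap.mulLeft F q).restrict hmem) ?_
  intro f g hfg
  have := congrArg Subtype.val hfg
  exact Subtype.ext (mul_left_cancel₀ hq this)

lemma rank_rrSpace_sub_le {r : E.toAffine.CoordinateRing} (hr : r ≠ 0) {δ : Divisor E K}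
    (hδ : ∀ Q, ringOrd (E.baseChange K).toAffine Q (ringMap E K r) = δ Q) (G : Divisor E K) :
    Module.rank F (rrSpace (G - δ)) ≤ Module.rank F (rrSpace G) := by
  have hr' : algebraMap _ E.toAffine.FunctionField r ≠ 0 := by simpa using hr
  have hr'' : ringMap E K r ≠ 0 := (map_ne_zero_iff _ ringMap_injective).mpr hr
  rw [sub_eq_add_neg]
  refine rank_rrSpace_add_le (inv_ne_zero hr') (fun Q => ?_) G
  rw [map_inv₀, ord_inv Q (funMap_ne_zero hr'), funMap_algebraMap, ord_algebraMap Q hr'', hδ,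
    Finsupp.neg_apply]

lemma le_rank_rrSpace_single_zero (m : ℕ) (hm : 1 ≤ m) :
    (m : Cardinal) ≤ Module.rank F (rrSpace (Finsupp.single 0 (m : ℤ) : Divisor E K)) := by
  -- The pole orders $0,2,3,\dots,m$: there are $m$ of them, order $1$ being absent.
  set e : Fin m → ℕ := fun i => if (i : ℕ) = 0 then 0 else i + 1 with he
  have he1 : ∀ i, e i ≠ 1 := fun i => by simp only [he]; split_ifs <;> omega
  have hem : ∀ i, e i ≤ m := fun i => by simp only [he]; split_ifs <;> omega
  have heinj : Function.Injective e := fun i j h => by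
    simp only [he] at h
    ext
    split_ifs at h <;> omega
  have hli : LinearIndependent F fun i => poleBasis E.toAffine (e i) := by
    rw [linearIndependent_iff']
    intro s g hg i hi
    have := congrArg (poleCoeff E.toAffine (e i)) hg
    rw [map_sum, map_zero, Finset.sum_eq_single i] at this
    · simpa [poleCoeff_poleBasis (he1 i)] using this
    · intro j _ hj
      rw [LinearMap.map_smul, poleCoeff_poleBasis (he1 j), if_neg fun h => hj (heinj h).symm,
        smul_zero]
    · exact fun h => (h hi).elim
  have hne : ∀ i, poleBasis E.toAffine (e i) ≠ 0 := fun i => hli.ne_zero i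
  let v : Fin m → rrSpace (Finsupp.single 0 (m : ℤ) : Divisor E K) := fun i =>
    ⟨algebraMap _ E.toAffine.FunctionField (poleBasis E.toAffine (e i)), by
      have h0 : ringMap E K (poleBasis E.toAffine (e i)) ≠ 0 :=
        (map_ne_zero_iff _ ringMap_injective).mpr (hne i)
      rw [mem_rrSpace (by simpa using hne i)]
      intro Q
      rw [funMap_algebraMap, ord_algebraMap Q h0]
      by_cases hQ : Q = 0
      · subst hQ
        rw [ringOrd_zero, Finsupp.single_eq_same, neg_add_eq_sub, sub_nonneg, Nat.cast_le,
          natDegree_norm_le_iff]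
        intro j hj
        rw [poleCoeff_ringMap, poleCoeff_poleBasis (he1 i), if_neg (by have := hem i; omega),
          map_zero]
      · rw [Finsupp.single_eq_of_ne hQ, add_zero]
        exact ringOrd_nonneg hQ _⟩
  have hv : LinearIndependent F v := by
    apply LinearIndependent.of_comp (Submodule.subtype _)
    have := hli.map' (IsScalarTower.toAlgHom F E.toAffine.CoordinateRing
      E.toAffine.FunctionField).toLinearMap (LinearMap.ker_eq_bot.mpr
        (IsFractionRing.injective E.toAffine.CoordinateRing E.toAffine.FunctionField))
    exact this
  simpa using hv.cardinal_lift_le_rank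


lemma mem_rrSpace_sub_single {G : Divisor E K} {P : Pts E K} {f : E.toAffine.FunctionField}
    (hf : f ∈ rrSpace G)
    (hP : f = 0 ∨ -G P < ord (E.baseChange K).toAffine P (funMap E K f)) :
    f ∈ rrSpace (G - Finsupp.single P 1) := by
  classical
  by_cases h0 : f = 0
  · rw [h0]; exact zero_mem _
  rw [mem_rrSpace h0] at hf ⊢
  replace hP := hP.resolve_left h0
  intro Q
  rw [Finsupp.sub_apply, Finsupp.single_apply]
  split_ifs with hQ
  · subst hQ; omega
  · simpa using hf Q

variable [DecidableEq F] [DecidableEq K] [IsGalois F K]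

lemma exists_function_value (P : Pts E F) {f g : E.toAffine.FunctionField} (hf : f ≠ 0)
    (hg : g ≠ 0) (h : ord (E.baseChange K).toAffine (incl P) (funMap E K g) ≤
      ord (E.baseChange K).toAffine (incl P) (funMap E K f)) :
    ∃ c : F, f - c • g = 0 ∨ ord (E.baseChange K).toAffine (incl P) (funMap E K g) <
      ord (E.baseChange K).toAffine (incl P) (funMap E K (f - c • g)) := by
  obtain ⟨r, s, t, hr, hs, ht, rfl, rfl⟩ :=
    exists_common_denom (A := E.toAffine.CoordinateRing) hf hg
  have hr' : ringMap E K r ≠ 0 := (map_ne_zero_iff _ ringMap_injective).mpr hr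
  have hs' : ringMap E K s ≠ 0 := (map_ne_zero_iff _ ringMap_injective).mpr hs
  have ht' : ringMap E K t ≠ 0 := (map_ne_zero_iff _ ringMap_injective).mpr ht
  rw [map_div₀, map_div₀, funMap_algebraMap, funMap_algebraMap, funMap_algebraMap,
    ord_div _ hs' ht', ord_div _ hr' ht'] at h
  obtain ⟨c, hc⟩ := exists_value_rational (K := K) P hr hs (by linarith)
  have hsub : algebraMap _ E.toAffine.FunctionField r / algebraMap _ E.toAffine.FunctionField t -
      c • (algebraMap _ E.toAffine.FunctionField s / algebraMap _ E.toAffine.FunctionField t) =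
      algebraMap _ E.toAffine.FunctionField (r - c • s) /
        algebraMap _ E.toAffine.FunctionField t := by
    have hcs : algebraMap _ E.toAffine.FunctionField (c • s) = c • algebraMap _ _ s :=
      map_smul (IsScalarTower.toAlgHom F E.toAffine.CoordinateRing E.toAffine.FunctionField) c s
    rw [map_sub, sub_div, hcs]
    simp only [Algebra.smul_def, mul_div_assoc]
  refine ⟨c, ?_⟩
  rw [hsub]
  by_cases h0 : r - c • s = 0
  · exact .inl (by rw [h0, map_zero, zero_div])
  right
  have h0' : ringMap E K (r - c • s) ≠ 0 := (map_ne_zero_iff _ ringMap_injective).mpr h0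
  rw [map_div₀, map_div₀, funMap_algebraMap, funMap_algebraMap, funMap_algebraMap,
    ord_div _ hs' ht', ord_div _ h0' ht']
  have := hc.resolve_left h0
  linarith

/-- Fix `g` in $L(G)$ outside $L(G-[P])$. Since `P` is rational, some `F`-multiple of `g` cancels
the leading term at `P` of any other element, so the quotient has dimension at most one. -/
lemma le_rank_rrSpace_sub_single (P : Pts E F) (G : Divisor E K) (n : ℕ)
    (h : ((n + 1 : ℕ) : Cardinal) ≤ Module.rank F (rrSpace G)) :
    (n : Cardinal) ≤ Module.rank F (rrSpace (G - Finsupp.single (incl P) 1)) := by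
  by_cases hle : rrSpace G ≤ rrSpace (G - Finsupp.single (incl P) 1)
  · exact (Nat.cast_le.mpr n.le_succ).trans (h.trans (Submodule.rank_mono hle))
  obtain ⟨g, hgG, hg⟩ := SetLike.not_le_iff_exists.mp hle
  have hg0 : g ≠ 0 := fun h => hg (h ▸ zero_mem _)
  have hgP : ord (E.baseChange K).toAffine (incl P) (funMap E K g) ≤ -G (incl P) := by
    by_contra! hlt
    exact hg (mem_rrSpace_sub_single hgG (.inr hlt))
  have hsup : rrSpace G ≤ Submodule.span F {g} ⊔ rrSpace (G - Finsupp.single (incl P) 1) := by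
    intro f hf
    by_cases hf0 : f = 0
    · rw [hf0]; exact zero_mem _
    have hfP := (mem_rrSpace hf0).mp hf (incl P)
    have hgP' := (mem_rrSpace hg0).mp hgG (incl P)
    obtain ⟨c, hc⟩ := exists_function_value (K := K) P hf0 hg0 (by linarith)
    rw [← add_sub_cancel (c • g) f]
    refine Submodule.add_mem_sup (Submodule.smul_mem _ c (Submodule.mem_span_singleton_self g)) ?_
    exact mem_rrSpace_sub_single (sub_mem hf (Submodule.smul_mem _ c hgG))
      (hc.imp_right fun h => by linarith)
  have h1 := (h.trans (Submodule.rank_mono hsup)).trans (Submodule.rank_add_le_rank_add_rank _ _)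
  have h2 : Module.rank F (Submodule.span F {g}) ≤ 1 := by
    simpa using rank_span_le (R := F) ({g} : Set E.toAffine.FunctionField)
  have h3 := h1.trans (add_le_add_left h2 _)
  rw [Nat.cast_add, Nat.cast_one, add_comm] at h3
  exact (Cardinal.add_one_le_add_one_iff).mp (by rwa [add_comm, add_comm _ (1 : Cardinal)])

end RiemannRoch


/-! ### The lower bound for the dimension of $L(G)$. -/

section Dimension

universe u v

variable {F : Type u} [Field F] {E : WeierstrassCurve F} {K : Type v} [Field K] [Algebra F K]

open Affine.CoordinateRing

lemma placeDivisor_eq (R : Finset (Pts E K)) : placeDivisor R = multisetDivisor R.val := rfl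

lemma divisorSum_eq [DecidableEq K] (G : Divisor E K) :
    divisorSum G = sumHom (E.baseChange K).toAffine G := by
  rw [divisorSum, sumHom, Finsupp.liftAddHom_apply]
  rfl

variable [IsAlgClosed K] [E.IsElliptic] [DecidableEq K]

/-- Since `R` sums to zero, the product of its point ideals has a generator $g$; scale it to have
leading coefficient $1$ at infinity. As `R` is Galois stable, $\sigma g-g$ is a multiple of $g$. If
nonzero it would have pole order at least that of $g$, but the leading terms cancel. So $g$ is fixed
and descends to `F`. -/
lemma exists_function_place [IsGalois F K] (R : Finset (Pts E K)) (h0 : 0 ∉ R)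
    (hR : ∀ σ : K ≃ₐ[F] K, ∀ Q ∈ R, galMap σ Q ∈ R)
    (hsum : divisorSum (placeDivisor R) = 0) :
    ∃ r : E.toAffine.CoordinateRing, r ≠ 0 ∧ ∀ Q : Pts E K,
      ringOrd (E.baseChange K).toAffine Q (ringMap E K r) =
        (placeDivisor R - Finsupp.single 0 (R.card : ℤ) : Divisor E K) Q := by
  have hs : ∀ P ∈ R.val, P ≠ 0 := fun P hP h => h0 (h ▸ hP)
  rw [divisorSum_eq, placeDivisor_eq, sumHom_multisetDivisor, sum_eq_zero_iff] at hsum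
  obtain ⟨c, hc, hprod⟩ := hsum
  have hdeg : (Algebra.norm K[X] c).natDegree = R.card := natDegree_norm_eq_card hs hprod
  set a := poleCoeff (E.baseChange K).toAffine R.card c with ha
  have ha0 : a ≠ 0 := by rw [ha, ← hdeg]; exact poleCoeff_natDegree_norm_ne_zero hc
  set g := a⁻¹ • c with hg
  have hg0 : g ≠ 0 := smul_ne_zero (inv_ne_zero ha0) hc
  have hprodg : (R.val.map pointIdeal).prod = Ideal.span {g} := by
    rw [hprod, hg, ← algebraMap_mul_eq_smul,
      Ideal.span_singleton_mul_left_unit (isUnit_algebraMap (inv_ne_zero ha0))]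
  have hdegg : (Algebra.norm K[X] g).natDegree = R.card := natDegree_norm_eq_card hs hprodg
  have hga : poleCoeff (E.baseChange K).toAffine R.card g = 1 := by
    rw [hg, LinearMap.map_smul, ← ha, smul_eq_mul, inv_mul_cancel₀ ha0]
  have hfix : ∀ σ : K ≃ₐ[F] K, conj E σ g = g := by
    intro σ
    have himage : R.map ⟨galMap σ, galMap_injective σ⟩ = R := by
      refine Finset.eq_of_subset_of_card_le (fun Q hQ => ?_) (by rw [Finset.card_map])
      obtain ⟨T, hT, rfl⟩ := Finset.mem_map.mp hQ
      exact hR σ T hT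
    have hmem : conj E σ g ∈ Ideal.span {g} := by
      have h1 : conj E σ g ∈ (Ideal.span {g}).map (conj E σ) :=
        Ideal.mem_map_of_mem _ (Ideal.mem_span_singleton_self g)
      rw [← hprodg] at h1
      have h2 : ((R.val.map pointIdeal).prod).map (conj E σ) = (R.val.map pointIdeal).prod := by
        rw [← Ideal.mapHom_apply, map_multiset_prod, Multiset.map_map]
        conv_rhs => rw [← himage, Finset.map_val, Multiset.map_map]
        congr 1
        exact Multiset.map_congr rfl fun Q _ => map_conj_pointIdeal σ Q
      rwa [h2, hprodg] at h1
    obtain ⟨e, he⟩ := Ideal.mem_span_singleton'.mp (Ideal.sub_mem _ hmem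
      (Ideal.mem_span_singleton_self g))
    by_contra hne
    have hd0 : conj E σ g - g ≠ 0 := sub_ne_zero.mpr hne
    have he0 : e ≠ 0 := by rintro rfl; exact hd0 (by rw [← he, zero_mul])
    have h3 : (Algebra.norm K[X] (conj E σ g - g)).natDegree =
        (Algebra.norm K[X] e).natDegree + R.card := by
      rw [← he, map_mul, natDegree_mul (norm_ne_zero he0) (norm_ne_zero hg0), hdegg]
    have h4 : (Algebra.norm K[X] (conj E σ g - g)).natDegree ≤ R.card := by
      rw [natDegree_norm_le_iff]
      intro i hi
      rw [map_sub, poleCoeff_conj, (natDegree_norm_le_iff g _).mp hdegg.le i hi, map_zero, sub_self]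
    have h5 := poleCoeff_natDegree_norm_ne_zero hd0
    rw [show (Algebra.norm K[X] (conj E σ g - g)).natDegree = R.card by omega, map_sub,
      poleCoeff_conj, hga, map_one, sub_self] at h5
    exact h5 rfl
  obtain ⟨r, hr⟩ := mem_range_ringMap g hfix
  refine ⟨r, ?_, fun Q => ?_⟩
  · rintro rfl
    exact hg0 (by rw [← hr, map_zero])
  · rw [hr, ringOrd_eq_of_prod hs hprodg]; rfl

lemma exists_function_vertical [DecidableEq F] (P : Pts E F) :
    ∃ r : E.toAffine.CoordinateRing, r ≠ 0 ∧ ∀ Q : Pts E K,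
      ringOrd (E.baseChange K).toAffine Q (ringMap E K r) =
        (Finsupp.single (incl P) 1 + Finsupp.single (incl (-P)) 1 - Finsupp.single 0 2 :
          Divisor E K) Q := by
  cases P with
  | zero =>
    refine ⟨1, one_ne_zero, fun Q => ?_⟩
    change _ = (Finsupp.single (incl (0 : Pts E F)) 1 + Finsupp.single (incl (-(0 : Pts E F))) 1 -
      Finsupp.single 0 2 : Divisor E K) Q
    rw [map_one, ringOrd_of_isUnit Q isUnit_one, neg_zero, map_zero, ← Finsupp.single_add,
      one_add_one_eq_two, sub_self, Finsupp.zero_apply]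
  | some x y h =>
    refine ⟨XClass _ (algebraMap F F x), XClass_ne_zero _, fun Q => ?_⟩
    rw [map_neg]
    have hP : ∃ y' h', (incl (.some x y h) : Pts E K) = .some (algebraMap F K x) y' h' :=
      ⟨_, _, rfl⟩
    obtain ⟨y', h', hP⟩ := hP
    rw [hP]
    have hX : ringMap E K (XClass E.toAffine (algebraMap F F x)) =
        XClass (E.baseChange K).toAffine (algebraMap F K x) := by
      rw [XClass, ringMap_mk, XClass]; simp
    have hs : ∀ T ∈ ({.some (algebraMap F K x) y' h', -.some (algebraMap F K x) y' h'} :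
        Multiset (Pts E K)), T ≠ 0 := by
      intro T hT
      rw [Multiset.insert_eq_cons, Multiset.mem_cons, Multiset.mem_singleton] at hT
      rcases hT with rfl | rfl
      · exact Affine.Point.some_ne_zero h'
      · exact neg_ne_zero.mpr (Affine.Point.some_ne_zero h')
    have hprod : (({.some (algebraMap F K x) y' h', -.some (algebraMap F K x) y' h'} :
        Multiset (Pts E K)).map pointIdeal).prod =
        Ideal.span {XClass (E.baseChange K).toAffine (algebraMap F K x)} := by
      rw [Multiset.insert_eq_cons, Multiset.map_cons, Multiset.prod_cons, Multiset.map_singleton,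
        Multiset.prod_singleton, mul_comm]
      exact XYIdeal_neg_mul h'
    rw [hX, ringOrd_eq_of_prod hs hprod]
    simp [multisetDivisor]

variable [DecidableEq F] [IsGalois F K]

/-- The vertical line through `P` gives $G+2[\mathcal O]\sim G+[P]+[-P]$; then the rational point
$-P$ is removed. -/
lemma le_rank_rrSpace_add_single (P : Pts E F) (G : Divisor E K) (n : ℕ)
    (h : ((n + 1 : ℕ) : Cardinal) ≤ Module.rank F (rrSpace (G + Finsupp.single 0 2))) :
    (n : Cardinal) ≤ Module.rank F (rrSpace (G + Finsupp.single (incl P) 1)) := by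
  obtain ⟨r, hr, hδ⟩ := exists_function_vertical (K := K) P
  have h1 := rank_rrSpace_sub_le hr hδ
    (G + Finsupp.single (incl P) 1 + Finsupp.single (incl (-P)) 1)
  rw [show G + Finsupp.single (incl P) 1 + Finsupp.single (incl (-P)) 1 -
    (Finsupp.single (incl P) 1 + Finsupp.single (incl (-P)) 1 - Finsupp.single 0 2) =
    G + Finsupp.single 0 2 by abel] at h1
  have := le_rank_rrSpace_sub_single (-P) _ n (h.trans h1)
  rwa [add_sub_cancel_right] at this

lemma le_rank_rrSpace_add_sum {n : ℕ} (P : Fin n → Pts E F) (G : Divisor E K) (m : ℕ)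
    (h : ((m + n : ℕ) : Cardinal) ≤
      Module.rank F (rrSpace (G + Finsupp.single 0 (2 * n : ℤ)))) :
    (m : Cardinal) ≤ Module.rank F (rrSpace (G + ∑ i, Finsupp.single (incl (P i)) 1)) := by
  induction n generalizing G with
  | zero =>
    have h0 : G + Finsupp.single 0 (2 * ((0 : ℕ) : ℤ)) = G := by simp
    rw [h0] at h
    rwa [Fin.sum_univ_zero, add_zero]
  | succ n ih =>
    rw [Fin.sum_univ_succ, ← add_assoc]
    refine ih (fun i => P i.succ) _ ?_
    rw [add_right_comm]
    refine le_rank_rrSpace_add_single (P 0) _ (m + n) ?_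
    have h0 : G + Finsupp.single 0 (2 * (n : ℤ)) + Finsupp.single 0 2 =
        G + Finsupp.single 0 (2 * ((n + 1 : ℕ) : ℤ)) := by
      rw [add_assoc, ← Finsupp.single_add]; push_cast; rw [mul_add, mul_one]
    rw [h0]
    exact h

lemma le_rank_rrSpace_place (R : Finset (Pts E K)) (h0 : 0 ∉ R) (hcard : 1 ≤ R.card)
    (hR : ∀ σ : K ≃ₐ[F] K, ∀ Q ∈ R, galMap σ Q ∈ R)
    (hsum : divisorSum (placeDivisor R) = 0) {n : ℕ} (P : Fin n → Pts E F) :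
    ((R.card + n : ℕ) : Cardinal) ≤
      Module.rank F (rrSpace (placeDivisor R + ∑ i, Finsupp.single (incl (P i)) 1)) := by
  obtain ⟨r, hr, hδ⟩ := exists_function_place R h0 hR hsum
  have h1 := rank_rrSpace_sub_le hr hδ (placeDivisor R + ∑ i, Finsupp.single (incl (P i)) 1)
  rw [show placeDivisor R + ∑ i, Finsupp.single (incl (P i)) 1 -
    (placeDivisor R - Finsupp.single 0 (R.card : ℤ)) =
    Finsupp.single 0 (R.card : ℤ) + ∑ i, Finsupp.single (incl (P i)) 1 by abel] at h1
  refine le_trans (le_rank_rrSpace_add_sum P _ _ ?_) h1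
  rw [← Finsupp.single_add]
  -- One `n` is the number of points; the other pays for the `n` dimensions lost when trading
  -- $2[\mathcal O]$ for a single point.
  have := le_rank_rrSpace_single_zero (F := F) (E := E) (K := K) (R.card + n + n) (by omega)
  rwa [show ((R.card + n + n : ℕ) : ℤ) = R.card + 2 * n by push_cast; ring] at this

end Dimension


/-! ### A zero-counting criterion for MDS codes. -/

section Code

variable {F : Type*} [Field F] [DecidableEq F] {ι : Type*} [Fintype ι]

lemma hammingDist_add_card_zeros (x y : ι → F) :
    hammingDist x y + (Finset.univ.filter fun i => (x - y) i = 0).card = Fintype.card ι := by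
  classical
  rw [hammingDist, ← Finset.card_univ,
    ← Finset.card_filter_add_card_filter_not (s := Finset.univ) (fun i => x i ≠ y i)]
  simp [sub_eq_zero]

/-- Some nonzero word vanishes on any prescribed set of fewer than $\dim C$ coordinates. With $k$
coordinates this bounds the dimension by $k$; with $k-1$ it gives a word attaining the Singleton
bound. -/
lemma finrank_and_minDist (C : Submodule F (ι → F)) {k : ℕ} (hk : 1 ≤ k)
    (hkι : k ≤ Fintype.card ι)
    (hz : ∀ c ∈ C, c ≠ 0 → (Finset.univ.filter fun i => c i = 0).card < k)
    (hrank : k ≤ Module.finrank F C) :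
    Module.finrank F C = k ∧ minDist (C : Set (ι → F)) + k = Fintype.card ι + 1 := by
  classical
  have restrict_ne : ∀ S : Finset ι, S.card < Module.finrank F C →
      ∃ c ∈ C, c ≠ 0 ∧ ∀ i ∈ S, c i = 0 := by
    intro S hS
    let φ : C →ₗ[F] (S → F) := (LinearMap.funLeft F F (fun i : S => (i : ι))).comp C.subtype
    have hker : LinearMap.ker φ ≠ ⊥ := by
      apply LinearMap.ker_ne_bot_of_finrank_lt
      rwa [Module.finrank_fintype_fun_eq_card, Fintype.card_coe]
    obtain ⟨c, hc, hc0⟩ := Submodule.exists_mem_ne_zero_of_ne_bot hker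
    refine ⟨c, c.2, fun h => hc0 (Subtype.ext h), fun i hi => ?_⟩
    exact congrFun (LinearMap.mem_ker.mp hc) ⟨i, hi⟩
  have card_le : ∀ (S : Finset ι) (c : ι → F), (∀ i ∈ S, c i = 0) →
      S.card ≤ (Finset.univ.filter fun i => c i = 0).card := fun S c h =>
    Finset.card_le_card fun i hi => by simpa using h i hi
  have hfin : Module.finrank F C = k := by
    refine le_antisymm ?_ hrank
    by_contra! hlt
    obtain ⟨S, -, hS⟩ := Finset.exists_subset_card_eq (s := (Finset.univ : Finset ι)) hkι
    obtain ⟨c, hc, hc0, hcS⟩ := restrict_ne S (by omega)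
    have := hz c hc hc0
    have := card_le S c hcS
    omega
  refine ⟨hfin, ?_⟩
  obtain ⟨S, -, hS⟩ := Finset.exists_subset_card_eq (s := (Finset.univ : Finset ι)) (n := k - 1)
    (by rw [Finset.card_univ]; omega)
  obtain ⟨c, hc, hc0, hcS⟩ := restrict_ne S (by omega)
  have h1 := card_le S c hcS
  have h2 := hz c hc hc0
  have h3 := hammingDist_add_card_zeros c 0
  rw [sub_zero] at h3
  have hmin : IsLeast {d | ∃ x ∈ (C : Set (ι → F)), ∃ y ∈ (C : Set (ι → F)), x ≠ y ∧
      hammingDist x y = d} (Fintype.card ι + 1 - k) := by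
    refine ⟨⟨c, hc, 0, C.zero_mem, hc0, by omega⟩, ?_⟩
    rintro _ ⟨x, hx, y, hy, hxy, rfl⟩
    have h4 := hz (x - y) (C.sub_mem hx hy) (sub_ne_zero.mpr hxy)
    have h5 := hammingDist_add_card_zeros x y
    omega
  rw [minDist, hmin.csInf_eq]
  omega

end Code

/-! ### Subgroups of index two and parity. -/

section Index

/-- An element of order two makes doubling non-injective, hence by finiteness non-surjective. So
$A/2A$ is a nonzero $\mathbb F_2$-space, and the kernel of a nonzero functional on it works. -/
lemma exists_index_eq_two {A : Type*} [AddCommGroup A] [Finite A] (h : Even (Nat.card A)) :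
    ∃ H : AddSubgroup A, H.index = 2 := by
  have h01 : ∀ z : ZMod 2, z = 0 ∨ z = 1 := by decide
  have := Fact.mk Nat.prime_two
  obtain ⟨x, hx⟩ := exists_prime_addOrderOf_dvd_card' 2 h.two_dvd
  let d : A →+ A := nsmulAddMonoidHom 2
  have hinj : ¬ Function.Injective d := by
    intro hd
    have h0 : x = 0 := hd (by
      rw [map_zero]
      change 2 • x = 0
      rw [← hx, addOrderOf_nsmul_eq_zero])
    rw [h0, addOrderOf_zero] at hx
    omega
  have hsurj : ¬ Function.Surjective d := fun hd => hinj (Finite.injective_iff_surjective.mpr hd)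
  rw [← AddMonoidHom.range_eq_top] at hsurj
  obtain ⟨a, ha⟩ : ∃ a, a ∉ d.range := by
    by_contra! H
    exact hsurj (eq_top_iff.mpr fun y _ => H y)
  let _ : Module (ZMod 2) (A ⧸ d.range) := AddCommGroup.zmodModule (n := 2) (by
    intro y
    obtain ⟨y, rfl⟩ := QuotientAddGroup.mk_surjective y
    rw [← QuotientAddGroup.mk_nsmul, QuotientAddGroup.eq_zero_iff]
    exact ⟨y, rfl⟩)
  have ha' : (a : A ⧸ d.range) ≠ 0 := by rwa [Ne, QuotientAddGroup.eq_zero_iff]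
  obtain ⟨φ, hφ⟩ : ∃ φ : Module.Dual (ZMod 2) (A ⧸ d.range), φ a ≠ 0 := by
    by_contra! H
    exact ha' ((Module.forall_dual_apply_eq_zero_iff (ZMod 2) _).mp H)
  let ψ : A →+ ZMod 2 := φ.toAddMonoidHom.comp (QuotientAddGroup.mk' d.range)
  have hψ : Function.Surjective ψ := by
    have h1 : ψ a = 1 := (h01 _).resolve_left hφ
    intro z
    rcases h01 z with rfl | rfl
    · exact ⟨0, map_zero ψ⟩
    · exact ⟨a, h1⟩
  refine ⟨ψ.ker, ?_⟩
  rw [AddSubgroup.index_ker, AddMonoidHom.range_eq_top.mpr hψ]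
  simp

lemma sum_mem_iff_even {A : Type*} [AddCommGroup A] {H : AddSubgroup A} (hH : H.index = 2)
    {ι : Type*} (s : Finset ι) (f : ι → A) (hf : ∀ i ∈ s, f i ∉ H) :
    ∑ i ∈ s, f i ∈ H ↔ Even s.card := by
  classical
  induction s using Finset.induction_on with
  | empty => simp [H.zero_mem]
  | insert a s ha ih =>
    rw [Finset.sum_insert ha, AddSubgroup.add_mem_iff_of_index_two hH,
      ih fun i hi => hf i (Finset.mem_insert_of_mem hi), Finset.card_insert_of_notMem ha,
      Nat.even_add_one]
    simp [hf a (Finset.mem_insert_self a s)]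

end Index

/-! ### Evaluation of functions and the MDS property. -/

section Evaluation

universe u v

variable {F : Type u} [Field F] {E : WeierstrassCurve F} {K : Type v} [Field K] [Algebra F K]
variable [DecidableEq K] [DecidableEq F]

lemma hasValueAt_iff {f : E.toAffine.FunctionField} {P : Pts E F} {c : F} :
    HasValueAt (K := K) f P c ↔ f - algebraMap F E.toAffine.FunctionField c = 0 ∨
      1 ≤ ord (E.baseChange K).toAffine (incl P)
        (funMap E K (f - algebraMap F E.toAffine.FunctionField c)) := Iff.rfl

variable [IsAlgClosed K] [E.IsElliptic]

/-- The divisor of `f` dominates $\sum_{P\in T}[P]-G$ and both have degree zero, so they coincide;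
principal divisors sum to zero. -/
lemma sumHom_eq_of_zeros {f : E.toAffine.FunctionField} (hf : f ≠ 0) {G : Divisor E K}
    (hfG : f ∈ rrSpace G) (T : Finset (Pts E F)) (hG : ∀ P ∈ T, G (incl P) = 0)
    (hT : ∀ P ∈ T, 0 < ord (E.baseChange K).toAffine (incl P) (funMap E K f))
    (hdeg : degHom (E.baseChange K).toAffine G = T.card) :
    sumHom (E.baseChange K).toAffine G = incl (∑ P ∈ T, P) := by
  obtain ⟨δ, hδ, hδd, hδs⟩ := exists_divisor (funMap_ne_zero (K := K) hf)
  set T' : Finset (Pts E K) := T.map ⟨incl, incl_injective⟩ with hT'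
  have hle : ∀ Q, (multisetDivisor T'.val - G : Divisor E K) Q ≤ δ Q := by
    intro Q
    have h1 := (mem_rrSpace hf).mp hfG Q
    rw [← hδ, Finsupp.sub_apply, multisetDivisor_apply]
    by_cases hQ : Q ∈ T'
    · rw [Multiset.count_eq_one_of_mem T'.nodup hQ]
      obtain ⟨P, hP, rfl⟩ := Finset.mem_map.mp hQ
      have h2 := hG P hP
      have h3 := hT P hP
      simp only [Function.Embedding.coeFn_mk]
      omega
    · rw [Multiset.count_eq_zero_of_notMem hQ]
      push_cast
      linarith
  have hdeg' : degHom (E.baseChange K).toAffine (multisetDivisor T'.val - G : Divisor E K) =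
      degHom (E.baseChange K).toAffine δ := by
    rw [map_sub, degHom_multisetDivisor, hdeg, hδd, Finset.card_val, hT', Finset.card_map, sub_self]
  have heq := eq_of_le_of_degHom_eq hle hdeg'
  rw [← heq, map_sub, sumHom_multisetDivisor, sub_eq_zero] at hδs
  rw [← hδs, hT', Finset.map_val, map_sum]
  rfl

lemma HasValueAt.add {f g : E.toAffine.FunctionField} {P : Pts E F} {a b : F}
    (hf : HasValueAt (K := K) f P a) (hg : HasValueAt (K := K) g P b) :
    HasValueAt (K := K) (f + g) P (a + b) := by
  rw [hasValueAt_iff] at *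
  rw [map_add, add_sub_add_comm]
  exact ord_funMap_add _ hf hg

lemma HasValueAt.smul {f : E.toAffine.FunctionField} {P : Pts E F} {a : F}
    (hf : HasValueAt (K := K) f P a) (c : F) : HasValueAt (K := K) (c • f) P (c * a) := by
  rw [hasValueAt_iff] at *
  have h : c • f - algebraMap F E.toAffine.FunctionField (c * a) =
      c • (f - algebraMap F E.toAffine.FunctionField a) := by
    rw [map_mul, smul_sub, Algebra.smul_def c (algebraMap F _ a)]
  rw [h]
  by_cases hc : c = 0
  · exact .inl (by rw [hc, zero_smul])
  by_cases h0 : f - algebraMap F E.toAffine.FunctionField a = 0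
  · exact .inl (by rw [h0, smul_zero])
  · rw [ord_funMap_smul _ hc h0]
    exact .inr (hf.resolve_left h0)

lemma HasValueAt.eq_zero {P : Pts E F} {a : F} (h : HasValueAt (E := E) (K := K) 0 P a) :
    a = 0 := by
  by_contra ha
  rw [hasValueAt_iff, zero_sub, neg_eq_zero, ← map_neg,
    funMap_algebraMap_base, ord_algebraMap_of_ne_zero] at h
  · refine h.elim (fun h => ha ?_) fun h => by omega
    exact (map_eq_zero_iff _ (algebraMap F E.toAffine.FunctionField).injective).mp h
  · exact (map_ne_zero_iff _ (algebraMap F K).injective).mpr (neg_ne_zero.mpr ha)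

lemma HasValueAt.unique {f : E.toAffine.FunctionField} {P : Pts E F} {a b : F}
    (ha : HasValueAt (K := K) f P a) (hb : HasValueAt (K := K) f P b) : a = b := by
  have := ha.add (hb.smul (-1))
  rw [neg_one_smul, add_neg_cancel, neg_one_mul] at this
  exact eq_of_sub_eq_zero (by rw [sub_eq_add_neg]; exact this.eq_zero)

lemma exists_hasValueAt [IsGalois F K] {G : Divisor E K} {f : E.toAffine.FunctionField}
    (hf : f ∈ rrSpace G) {P : Pts E F} (hP : G (incl P) = 0) : ∃ c, HasValueAt (K := K) f P c := by
  by_cases hf0 : f = 0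
  · exact ⟨0, .inl (by rw [hf0, map_zero, sub_zero])⟩
  have h := (mem_rrSpace hf0).mp hf (incl P)
  -- The order of `f` at `P` is nonnegative, so comparison with the constant function $1$ yields the
  -- value.
  obtain ⟨c, hc⟩ := exists_function_value (K := K) P hf0 one_ne_zero (by
    rw [map_one, ord_one]; linarith)
  rw [map_one, ord_one, ← Algebra.algebraMap_eq_smul_one] at hc
  exact ⟨c, hc⟩

lemma exists_eval [IsGalois F K] {G : Divisor E K} {D : Finset (Pts E F)}
    (hD : ∀ P ∈ D, G (incl P) = 0) :
    ∃ ev : rrSpace G →ₗ[F] (D → F), ∀ (f : rrSpace G) (P : D),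
      HasValueAt (K := K) (f : E.toAffine.FunctionField) (P : Pts E F) (ev f P) := by
  choose ev hev using fun (f : rrSpace G) (P : D) => exists_hasValueAt f.2 (hD P P.2)
  exact ⟨{ toFun := ev
           map_add' := fun f g => funext fun P => (hev (f + g) P).unique ((hev f P).add (hev g P))
           map_smul' := fun c f => funext fun P => (hev (c • f) P).unique ((hev f P).smul c) }, hev⟩

/-- By `hsum` no nonzero function has `k` zeros on `D`. As `k ≤ D.card`, evaluation is then
injective, and the rank bound passes to the code. -/
lemma isMDS_of_rank [IsGalois F K] {G : Divisor E K} {D : Finset (Pts E F)} {k : ℕ} (hk : 1 ≤ k)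
    (hkD : k ≤ D.card) (hrat : IsRational G) (hD : ∀ P ∈ D, G (incl P) = 0)
    (hdeg : degHom (E.baseChange K).toAffine G = k)
    (hrank : (k : Cardinal) ≤ Module.rank F (rrSpace G))
    (hsum : ∀ T ⊆ D, T.card = k → sumHom (E.baseChange K).toAffine G ≠ incl (∑ P ∈ T, P)) :
    IsMDSEllipticCode D G D.card k := by
  refine ⟨hrat, fun P hP => Finsupp.notMem_support_iff.mpr (hD P hP), rfl, ?_⟩
  obtain ⟨ev, hev⟩ := exists_eval hD
  have hzeros : ∀ f, f ≠ 0 → (Finset.univ.filter fun P => ev f P = 0).card < k := by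
    intro f hf
    by_contra! hle
    obtain ⟨S, hS, hSk⟩ := Finset.exists_subset_card_eq hle
    have hf0 : (f : E.toAffine.FunctionField) ≠ 0 := fun h => hf (Subtype.ext h)
    refine hsum (S.map (Function.Embedding.subtype _)) ?_ ?_ ?_
    · intro P hP
      obtain ⟨Q, -, rfl⟩ := Finset.mem_map.mp hP
      exact Q.2
    · rw [Finset.card_map, hSk]
    · refine sumHom_eq_of_zeros hf0 f.2 _ ?_ ?_ (by rw [Finset.card_map, hSk, hdeg])
      · intro P hP
        obtain ⟨Q, -, rfl⟩ := Finset.mem_map.mp hP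
        exact hD _ Q.2
      · intro P hP
        obtain ⟨Q, hQ, rfl⟩ := Finset.mem_map.mp hP
        have h1 := hev f Q
        rw [(Finset.mem_filter.mp (hS hQ)).2, hasValueAt_iff, map_zero, sub_zero] at h1
        exact h1.resolve_left hf0
  have hinj : Function.Injective ev := by
    rw [injective_iff_map_eq_zero]
    intro f hf
    by_contra hf0
    have := hzeros f hf0
    rw [hf] at this
    simp only [Pi.zero_apply, Finset.filter_true, Finset.card_univ, Fintype.card_coe] at this
    omega
  refine ⟨LinearMap.range ev, ?_, ?_⟩
  · ext c
    constructor
    · rintro ⟨f, rfl⟩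
      exact ⟨f, f.2, hev f⟩
    · rintro ⟨f, hf, hc⟩
      exact ⟨⟨f, hf⟩, funext fun P => (hev ⟨f, hf⟩ P).unique (hc P)⟩
  · have h := finrank_and_minDist (LinearMap.range ev) hk (by rwa [Fintype.card_coe]) ?_ ?_
    · rwa [Fintype.card_coe] at h
    · rintro _ ⟨f, rfl⟩ hf
      exact hzeros f fun h => hf (by rw [h, map_zero])
    · rw [← Nat.cast_le (α := Cardinal), Module.finrank_eq_rank]
      rwa [← (LinearEquiv.ofInjective ev hinj).rank_eq]

end Evaluation


/-! ### Places, rational points, and codes from $[R]+\sum[P_i]$. -/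

section Places

universe u v

variable {F : Type u} [Field F] {E : WeierstrassCurve F} {K : Type v} [Field K] [Algebra F K]
variable [DecidableEq K]

lemma galMap_galMap (σ τ : K ≃ₐ[F] K) (Q : Pts E K) :
    galMap σ (galMap τ Q) = galMap (τ.trans σ) Q := by
  cases Q <;> rfl

lemma IsPlace.galMap_mem {R : Finset (Pts E K)} (hR : IsPlace R) (σ : K ≃ₐ[F] K) {Q : Pts E K}
    (hQ : Q ∈ R) : galMap σ Q ∈ R := by
  obtain ⟨Q₀, hQ₀⟩ := hR
  obtain ⟨τ, rfl⟩ := (hQ₀ Q).mp hQ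
  exact (hQ₀ _).mpr ⟨τ.trans σ, (galMap_galMap σ τ Q₀).symm⟩

/-- A rational point is Galois fixed, so its orbit is a singleton. In particular `R` avoids both the
evaluation points and the point at infinity. -/
lemma IsPlace.incl_notMem [DecidableEq F] {R : Finset (Pts E K)} (hR : IsPlace R)
    (hcard : 1 < R.card) (P : Pts E F) : incl P ∉ R := by
  intro hP
  obtain ⟨Q₀, hQ₀⟩ := hR
  obtain ⟨τ, hτ⟩ := (hQ₀ _).mp hP
  have h0 : Q₀ = incl P := galMap_injective τ (hτ.trans (galMap_incl τ P).symm)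
  have : R ⊆ {incl P} := by
    intro Q hQ
    obtain ⟨σ, rfl⟩ := (hQ₀ Q).mp hQ
    rw [Finset.mem_singleton, h0]
    exact galMap_incl σ P
  have := Finset.card_le_card this
  rw [Finset.card_singleton] at this
  omega

lemma placeDivisor_galMap {R : Finset (Pts E K)} (hR : IsPlace R) (σ : K ≃ₐ[F] K) (Q : Pts E K) :
    placeDivisor R (galMap σ Q) = placeDivisor R Q := by
  have h : galMap σ Q ∈ R ↔ Q ∈ R := by
    refine ⟨fun h => ?_, hR.galMap_mem σ⟩
    have := hR.galMap_mem σ.symm h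
    rwa [galMap_symm_galMap] at this
  rw [placeDivisor_eq, multisetDivisor_apply, multisetDivisor_apply]
  by_cases hQ : Q ∈ R
  · rw [Multiset.count_eq_one_of_mem R.nodup hQ, Multiset.count_eq_one_of_mem R.nodup (h.mpr hQ)]
  · rw [Multiset.count_eq_zero_of_notMem hQ, Multiset.count_eq_zero_of_notMem fun h' => hQ (h.mp h')]

variable [DecidableEq F]

lemma pointDivisor_eq (P : Pts E F) :
    (pointDivisor P : Divisor E K) = Finsupp.single (incl P) 1 := rfl

lemma isRational_place_add_sum {R : Finset (Pts E K)} (hR : IsPlace R) {n : ℕ}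
    (P : Fin n → Pts E F) : IsRational (placeDivisor R + ∑ i, pointDivisor (P i)) := by
  intro σ Q
  change (_ : Divisor E K) (galMap σ Q) = _
  rw [Finsupp.add_apply, Finsupp.add_apply, placeDivisor_galMap hR, Finsupp.finsetSum_apply,
    Finsupp.finsetSum_apply]
  congr 1
  refine Finset.sum_congr rfl fun i _ => ?_
  rw [pointDivisor_eq, Finsupp.single_apply, Finsupp.single_apply]
  congr 1
  rw [← galMap_incl σ (P i), (galMap_injective σ).eq_iff, galMap_incl]

lemma isMDS_place [IsAlgClosed K] [IsGalois F K] [E.IsElliptic] {R : Finset (Pts E K)}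
    (hR : IsPlace R) (hcard : 1 < R.card) (hsum : divisorSum (placeDivisor R) = 0) {n : ℕ}
    (P : Fin n → Pts E F) (D : Finset (Pts E F)) (hD : R.card + n ≤ D.card)
    (hdisj : ∀ i, P i ∉ D)
    (hT : ∀ T ⊆ D, T.card = R.card + n → ∑ Q ∈ T, Q ≠ ∑ i, P i) :
    IsMDSEllipticCode D (placeDivisor R + ∑ i, pointDivisor (P i)) D.card (R.card + n) := by
  have hR0 : (0 : Pts E K) ∉ R := by
    have := hR.incl_notMem hcard (0 : Pts E F)
    rwa [map_zero] at this
  refine isMDS_of_rank (by omega) hD (isRational_place_add_sum hR P) ?_ ?_ ?_ ?_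
  · intro Q hQ
    rw [Finsupp.add_apply, Finsupp.finsetSum_apply, placeDivisor_eq, multisetDivisor_apply,
      Multiset.count_eq_zero_of_notMem (hR.incl_notMem hcard Q), Finset.sum_eq_zero]
    · rfl
    · intro i _
      rw [pointDivisor_eq, Finsupp.single_eq_of_ne]
      exact fun h => hdisj i (incl_injective h ▸ hQ)
  · rw [map_add, placeDivisor_eq, degHom_multisetDivisor, map_sum]
    simp [pointDivisor_eq]
  · exact le_rank_rrSpace_place R hR0 (by omega) (fun σ Q hQ => hR.galMap_mem σ hQ) hsum P
  · intro T hTD hTk h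
    rw [map_add, ← divisorSum_eq, hsum, zero_add, map_sum] at h
    refine hT T hTD hTk (incl_injective (K := K) ?_)
    rw [← h, map_sum]
    simp [pointDivisor_eq]

instance [Finite F] : Finite (Pts E F) :=
  have : Finite (WithZero {xy : F × F // (E.baseChange F).toAffine.Nonsingular xy.1 xy.2}) :=
    inferInstanceAs (Finite (Option _))
  Finite.of_equiv _ (Affine.nonsingularPointEquiv (E.baseChange F).toAffine).symm

lemma exists_finset_subgroup [Finite F] {H : AddSubgroup (Pts E F)} (hH : H.index = 2) :
    ∃ D : Finset (Pts E F), (∀ Q, Q ∈ D ↔ Q ∈ H) ∧ D.card = Nat.card (Pts E F) / 2 := by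
  refine ⟨(H : Set (Pts E F)).toFinite.toFinset, fun Q => by simp, ?_⟩
  rw [← Nat.card_eq_card_finite_toFinset, ← H.card_mul_index, hH]
  simp

lemma exists_finset_coset [Finite F] {H : AddSubgroup (Pts E F)} (hH : H.index = 2)
    (u : Pts E F) :
    ∃ D : Finset (Pts E F), (∀ Q, Q ∈ D ↔ ∃ h ∈ H, Q = u + h) ∧
      D.card = Nat.card (Pts E F) / 2 := by
  obtain ⟨D, hD, hcard⟩ := exists_finset_subgroup hH
  refine ⟨D.map (addLeftEmbedding u), fun Q => ?_, by rw [Finset.card_map, hcard]⟩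
  simp [hD, eq_comm]

end Places

end EllipticCode

end

/-! ### The main theorem. -/

open EllipticCode in
theorem mainTheorem6 {F : Type*} [Field F] [Finite F] [DecidableEq F]
    {K : Type*} [Field K] [DecidableEq K] [Algebra F K] [IsAlgClosure F K]
    (E : WeierstrassCurve F) [E.IsElliptic]
    (hN : Even (Nat.card (EllipticCode.Pts E F)))
    (R : Finset (EllipticCode.Pts E K)) (hR : EllipticCode.IsPlace R)
    (l : ℕ) (hRl : R.card = l) (hodd : Odd l) (hl : 2 < l)
    (hsum : EllipticCode.divisorSum (EllipticCode.placeDivisor R) = 0)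
    (k : ℕ) (hlk : l ≤ k) (hk : k ≤ Nat.card (EllipticCode.Pts E F) / 2) :
    (∃ (D : Finset (EllipticCode.Pts E F)) (G : EllipticCode.Divisor E K),
      EllipticCode.IsMDSEllipticCode D G (Nat.card (EllipticCode.Pts E F) / 2) k) ∧
    (∃ H : AddSubgroup (EllipticCode.Pts E F), H.index = 2) ∧
    ∀ H : AddSubgroup (EllipticCode.Pts E F), H.index = 2 →
      ∀ u : EllipticCode.Pts E F, u ∉ H →
      ∀ P : Fin (k - l) → EllipticCode.Pts E F,
        (Even k → (∀ i, ∃ h ∈ H, P i = u + h) →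
          ∃ D : Finset (EllipticCode.Pts E F), (∀ Q, Q ∈ D ↔ Q ∈ H) ∧
            EllipticCode.IsMDSEllipticCode D
              (EllipticCode.placeDivisor R + ∑ i, EllipticCode.pointDivisor (P i))
              (Nat.card (EllipticCode.Pts E F) / 2) k) ∧
        (Odd k → (∀ i, P i ∈ H) →
          ∃ D : Finset (EllipticCode.Pts E F), (∀ Q, Q ∈ D ↔ ∃ h ∈ H, Q = u + h) ∧
            EllipticCode.IsMDSEllipticCode D
              (EllipticCode.placeDivisor R + ∑ i, EllipticCode.pointDivisor (P i))
              (Nat.card (EllipticCode.Pts E F) / 2) k) := by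
  have : IsAlgClosed K := IsAlgClosure.isAlgClosed F
  -- Finite fields are perfect, so the algebraic closure is separable as well as normal.
  have : IsGalois F K := ⟨⟩
  have key : ∀ H : AddSubgroup (EllipticCode.Pts E F), H.index = 2 →
      ∀ u : EllipticCode.Pts E F, u ∉ H →
      ∀ P : Fin (k - l) → EllipticCode.Pts E F,
        (Even k → (∀ i, ∃ h ∈ H, P i = u + h) →
          ∃ D : Finset (EllipticCode.Pts E F), (∀ Q, Q ∈ D ↔ Q ∈ H) ∧
            EllipticCode.IsMDSEllipticCode D
              (EllipticCode.placeDivisor R + ∑ i, EllipticCode.pointDivisor (P i))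
              (Nat.card (EllipticCode.Pts E F) / 2) k) ∧
        (Odd k → (∀ i, P i ∈ H) →
          ∃ D : Finset (EllipticCode.Pts E F), (∀ Q, Q ∈ D ↔ ∃ h ∈ H, Q = u + h) ∧
            EllipticCode.IsMDSEllipticCode D
              (EllipticCode.placeDivisor R + ∑ i, EllipticCode.pointDivisor (P i))
              (Nat.card (EllipticCode.Pts E F) / 2) k) := by
    intro H hH u hu P
    have hcoset : ∀ Q, (∃ h ∈ H, Q = u + h) → Q ∉ H := by
      rintro _ ⟨h, hh, rfl⟩ hmem
      exact hu ((H.add_mem_cancel_right hh).mp hmem)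
    have hkl : R.card + (k - l) = k := by omega
    constructor
    · intro hkeven hP
      obtain ⟨D, hD, hcard⟩ := exists_finset_subgroup hH
      refine ⟨D, hD, ?_⟩
      -- Oddness of `l` enters here: $k-l$ is odd, whereas subsets of $H$ have their sum in $H$.
      have hPsum : ∑ i, P i ∉ H := by
        rw [sum_mem_iff_even hH _ _ fun i _ => hcoset _ (hP i), Finset.card_univ, Fintype.card_fin,
          Nat.not_even_iff_odd]
        exact Nat.Even.sub_odd hlk hkeven hodd
      have := isMDS_place hR (by omega) hsum P D (by omega)
        (fun i hi => hcoset _ (hP i) ((hD _).mp hi))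
        (fun T hT _ h => hPsum (h ▸ H.sum_mem fun Q hQ => (hD Q).mp (hT hQ)))
      rwa [hcard, hkl] at this
    · intro hkodd hP
      obtain ⟨D, hD, hcard⟩ := exists_finset_coset hH u
      refine ⟨D, hD, ?_⟩
      have := isMDS_place hR (by omega) hsum P D (by omega)
        (fun i hi => hcoset _ ((hD _).mp hi) (hP i))
        (fun T hT hTk h => by
          -- An odd number $k$ of elements outside $H$ cannot sum to the element $\sum P_i$ of $H$.
          have h1 : ∑ Q ∈ T, Q ∈ H := h ▸ H.sum_mem fun i _ => hP i
          rw [sum_mem_iff_even hH T _ fun Q hQ => hcoset Q ((hD Q).mp (hT hQ)), hTk, hkl] at h1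
          exact Nat.not_even_iff_odd.mpr hkodd h1)
      rwa [hcard, hkl] at this
  obtain ⟨H, hH⟩ := exists_index_eq_two hN
  refine ⟨?_, ⟨H, hH⟩, key⟩
  obtain ⟨u, hu⟩ : ∃ u, u ∉ H := by
    by_contra! h
    rw [(AddSubgroup.eq_top_iff' H).mpr h, AddSubgroup.index_top] at hH
    omega
  -- Repeated points are allowed, so all $P_i$ may be taken equal to `u` or to `0` according to
  -- parity.
  rcases Nat.even_or_odd k with hkp | hkp
  · obtain ⟨D, -, hD⟩ := (key H hH u hu fun _ => u).1 hkp fun _ => ⟨0, H.zero_mem, (add_zero u).symm⟩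
    exact ⟨D, _, hD⟩
  · obtain ⟨D, -, hD⟩ := (key H hH u hu fun _ => 0).2 hkp fun _ => H.zero_mem
    exact ⟨D, _, hD⟩
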